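/- For $p\in\mathbb{R}^3$ put $\widehat p = p/\sqrt{1+|p|^2}$. Let $I\subset\mathbb{R}$ be an interval of positive length containing $0$, and let $(f,E,B)$ be a classical solution on $I$ of the relativistic Vlasov–Maxwell system, i.e. $f\in C^1(I\times\mathbb{R}^3\times\mathbb{R}^3;\mathbb{R})$, $E,B\in C^1(I\times\mathbb{R}^3;\mathbb{R}^3)$ and $$\partial_t f+\widehat p\cdot\partial_x f+(E+\widehat p\times B)\cdot\partial_p f=0,$$ $$\partial_t E-\mathrm{curl}\,B=-4\pi j,\quad \partial_t B+\mathrm{curl}\,E=0,\quad \mathrm{div}\,E=4\pi\rho,\quad \mathrm{div}\,B=0,$$ $$\rho(t,x)=\int f(t,x,p)\,dp,\qquad j(t,x)=\int\widehat p\,f(t,x,p)\,dp .$$ Suppose that the initial data $\mathring f=f(0)$, $\mathring E=E(0)$, $\mathring B=B(0)$ satisfy $\mathring f\in C^1_c(\mathbb{R}^6)$, $\mathring f\ge 0$, and $\mathring E,\mathring B\in C^2(\mathbb{R}^3)\cap L^2(\mathbb{R}^3)$ (for instance $\mathring E,\mathring B\in C_c^2(\mathbb{R}^3)$). Then for all $t\in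 I$ the functions $\rho(t)$ and $j(t)$ belong to $L^{4/3}(\mathbb{R}^3)$ and $$\|\rho(t)\|_{4/3}\le C,\qquad \|j(t)\|_{4/3}\le C,$$ where the constant $C$ depends only on upper bounds for the initial energy $$\iint\sqrt{1+|p|^2}\,\mathring f(x,p)\,dp\,dx+\frac1{8\pi}\int\bigl(|\mathring E(x)|^2+|\mathring B(x)|^2\bigr)\,dx$$ and for $\|\mathring f\|_\infty$, and on nothing else (in particular not on $t$, $I$ or the solution). -/

import Mathlib

noncomputable section

namespace RVM

open MeasureTheory Set

/-- Euclidean three-space, used for positions, momenta and field values. -/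
abbrev R3 : Type := EuclideanSpace ℝ (Fin 3)

/-- The relativistic weight `√(1 + |p|²)`. -/
def gam (p : R3) : ℝ := Real.sqrt (1 + ‖p‖ ^ 2)

/-- The velocity `p / √(1 + |p|²)` of a particle with momentum `p`. -/
def vel (p : R3) : R3 := (gam p)⁻¹ • p

/-- The vector product on Euclidean three-space. -/
def cross (u v : R3) : R3 := WithLp.toLp 2 (crossProduct (WithLp.ofLp u) (WithLp.ofLp v))

/-- `pd F i k x` is the partial derivative of the `k`-th component of `F` in the `i`-th direction. -/
def pd (F : R3 → R3) (i k : Fin 3) (x : R3) : ℝ :=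
  fderiv ℝ F x (EuclideanSpace.single i 1) k

/-- The curl of a vector field. -/
def curl (F : R3 → R3) (x : R3) : R3 :=
  !₂[pd F 1 2 x - pd F 2 1 x, pd F 2 0 x - pd F 0 2 x, pd F 0 1 x - pd F 1 0 x]

/-- The divergence of a vector field. -/
def divg (F : R3 → R3) (x : R3) : ℝ := ∑ i, pd F i i x

/-- The charge density `ρ(x) = ∫ f(x,p) dp` of a phase space density. -/
def rho (g : R3 → R3 → ℝ) (x : R3) : ℝ := ∫ p, g x p

/-- The current density `j(x) = ∫ (p / √(1 + |p|²)) f(x,p) dp` of a phase space density. -/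
def cur (g : R3 → R3 → ℝ) (x : R3) : R3 := ∫ p, g x p • vel p

/-- The total (kinetic plus field) energy. -/
def energy (g : R3 → R3 → ℝ) (E B : R3 → R3) : ℝ :=
  (∫ x, ∫ p, gam p * g x p) + 1 / (8 * Real.pi) * ∫ x, (‖E x‖ ^ 2 + ‖B x‖ ^ 2)

/-- Admissible initial data. The particle density is `C¹`, nonnegative and compactly supported. The
fields are `C²` with finite field energy; `C²` fields of compact support are a special case.
(Compact support of the electric field is not imposed: together with Gauss' law and a nonnegative
density it would force the density to vanish.) -/
structure IsInitialData (f₀ : R3 → R3 → ℝ) (E₀ B₀ : R3 → R3) : Prop where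
  contDiff_f : ContDiff ℝ 1 (fun z : R3 × R3 => f₀ z.1 z.2)
  hasCompactSupport_f : HasCompactSupport (fun z : R3 × R3 => f₀ z.1 z.2)
  nonneg_f : ∀ x p, 0 ≤ f₀ x p
  contDiff_E : ContDiff ℝ 2 E₀
  contDiff_B : ContDiff ℝ 2 B₀
  memLp_E : MemLp E₀ 2 volume
  memLp_B : MemLp B₀ 2 volume
  gauss : ∀ x, divg E₀ x = 4 * Real.pi * rho f₀ x
  div_B : ∀ x, divg B₀ x = 0

/-- `(f, E, B)` is a classical, i.e. continuously differentiable, solution of the relativistic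
Vlasov-Maxwell system on the time interval `I`. Time derivatives are taken within `I`, so that they
are one-sided at an end point of `I` that belongs to `I`, and ordinary ones in the interior. No decay
or support property is imposed at any time. -/
structure IsClassicalSolution (I : Set ℝ) (f : ℝ → R3 → R3 → ℝ) (E B : ℝ → R3 → R3) : Prop where
  contDiffOn_f : ContDiffOn ℝ 1 (fun z : ℝ × R3 × R3 => f z.1 z.2.1 z.2.2) (I ×ˢ univ)
  contDiffOn_E : ContDiffOn ℝ 1 (fun z : ℝ × R3 => E z.1 z.2) (I ×ˢ univ)
  contDiffOn_B : ContDiffOn ℝ 1 (fun z : ℝ × R3 => B z.1 z.2) (I ×ˢ univ)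
  vlasov : ∀ t ∈ I, ∀ x p,
    derivWithin (fun s => f s x p) I t
      + fderiv ℝ (fun y => f t y p) x (vel p)
      + fderiv ℝ (fun q => f t x q) p (E t x + cross (vel p) (B t x)) = 0
  ampere : ∀ t ∈ I, ∀ x,
    derivWithin (fun s => E s x) I t - curl (B t) x = -(4 * Real.pi) • cur (f t) x
  faraday : ∀ t ∈ I, ∀ x, derivWithin (fun s => B s x) I t + curl (E t) x = 0
  gauss : ∀ t ∈ I, ∀ x, divg (E t) x = 4 * Real.pi * rho (f t) x
  div_B : ∀ t ∈ I, ∀ x, divg (B t) x = 0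

end RVM

end

noncomputable section

namespace RVM

open MeasureTheory Set Metric
open scoped NNReal

/-! ### The weight, the velocity and the vector product -/

/-! The proof combines an energy bound with an interpolation in momentum. Where `0 ≤ g ≤ M`, cutting
momentum space at `|p| = r` gives `ρ ≤ M |B₁| r³ + k / r` with `k = ∫ γ g dp`, and `r = k^(1/4)`
turns this into `ρ ≤ (M |B₁| + 1) k^(3/4)` (`integral_le_mul_rpow`). Hence `∫ ρ^(4/3) dx` is
controlled by the kinetic energy, and `|j| ≤ ρ` because velocities have norm at most `1`. It remains
to bound `f` and its kinetic energy by the data.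

The density is constant along characteristics (`exists_eq_initial`), so it stays nonnegative and
below the initial supremum, and on a compact time interval its support stays in a fixed compact set
(`exists_support_bound`).

The fields are not assumed to decay or to be square integrable at later times, so the energy cannot
simply be integrated over all of space. It is localized by a cutoff of `gam x + σ t`, where `gam` is
a smooth substitute for `|x|` whose gradient `vel` has norm at most `1`. Neither particles nor
fields outrun light, so the flux through the smoothed cone has a sign (`antitoneOn_energy`), while
the work done by the electric field cancels between particles and fields. A cone wide enough to
contain the particles at time `t` then bounds the kinetic energy by the full initial energy
(`integral_gam_mul_le`). -/

theorem gam_pos (p : R3) : 0 < gam p := Real.sqrt_pos.2 (by positivity)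

theorem one_le_gam (p : R3) : 1 ≤ gam p := Real.one_le_sqrt.2 (by nlinarith [sq_nonneg ‖p‖])

theorem norm_lt_gam (p : R3) : ‖p‖ < gam p := Real.lt_sqrt_of_sq_lt (by linarith)

theorem contDiff_gam : ContDiff ℝ 1 gam :=
  (contDiff_const.add (contDiff_norm_sq ℝ)).sqrt fun p => by positivity

theorem contDiff_vel : ContDiff ℝ 1 vel :=
  (contDiff_gam.inv fun p => (gam_pos p).ne').smul contDiff_id

theorem norm_vel_le (p : R3) : ‖vel p‖ ≤ 1 := by
  rw [vel, norm_smul, norm_inv, Real.norm_of_nonneg (gam_pos p).le, inv_mul_le_iff₀ (gam_pos p)]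
  linarith [norm_lt_gam p]

theorem gam_smul_vel (p : R3) : gam p • vel p = p := by
  rw [vel, smul_smul, mul_inv_cancel₀ (gam_pos p).ne', one_smul]

theorem fderiv_gam (p v : R3) : fderiv ℝ gam p v = inner ℝ (vel p) v := by
  have h : HasFDerivAt gam _ p := ((hasFDerivAt_id p).norm_sq.const_add 1).sqrt (by positivity)
  rw [h.fderiv]
  simp only [smul_apply, ContinuousLinearMap.comp_apply,
    innerSL_apply_apply, vel, inner_smul_left, ContinuousLinearMap.id_apply, smul_eq_mul, id]
  rw [show √(1 + ‖p‖ ^ 2) = gam p from rfl]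
  have := (gam_pos p).ne'
  simp
  field_simp

theorem cross_apply_zero (u v : R3) : cross u v 0 = u 1 * v 2 - u 2 * v 1 := by
  simp [cross, cross_apply]

theorem cross_apply_one (u v : R3) : cross u v 1 = u 2 * v 0 - u 0 * v 2 := by
  simp [cross, cross_apply]

theorem cross_apply_two (u v : R3) : cross u v 2 = u 0 * v 1 - u 1 * v 0 := by
  simp [cross, cross_apply]

theorem contDiff_cross {n : WithTop ℕ∞} : ContDiff ℝ n (fun z : R3 × R3 => cross z.1 z.2) := by
  have h (i : Fin 3) : ContDiff ℝ n (fun z : R3 × R3 => z.1 i) :=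
    (contDiff_euclidean.1 contDiff_fst) i
  have h' (i : Fin 3) : ContDiff ℝ n (fun z : R3 × R3 => z.2 i) :=
    (contDiff_euclidean.1 contDiff_snd) i
  refine contDiff_euclidean.2 fun i => ?_
  fin_cases i
  · simpa only [Fin.zero_eta, cross_apply_zero] using ((h 1).mul (h' 2)).sub ((h 2).mul (h' 1))
  · simpa only [Fin.mk_one, cross_apply_one] using ((h 2).mul (h' 0)).sub ((h 0).mul (h' 2))
  · simpa only [Fin.reduceFinMk, cross_apply_two] using ((h 0).mul (h' 1)).sub ((h 1).mul (h' 0))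

theorem cross_smul_left (c : ℝ) (u v : R3) : cross (c • u) v = c • cross u v := by
  simp [cross]

theorem norm_cross_le (u v : R3) : ‖cross u v‖ ≤ ‖u‖ * ‖v‖ := by
  refine abs_le_of_sq_le_sq' ?_ (by positivity) |>.2
  rw [mul_pow, EuclideanSpace.norm_sq_eq, EuclideanSpace.norm_sq_eq, EuclideanSpace.norm_sq_eq]
  simp only [Fin.sum_univ_three, cross_apply_zero, cross_apply_one, cross_apply_two,
    Real.norm_eq_abs, sq_abs]
  nlinarith [sq_nonneg (u 0 * v 0 + u 1 * v 1 + u 2 * v 2)]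

/-! ### Differentiability on a time slab -/

section Slab

variable {Y Z : Type*} [NormedAddCommGroup Y] [NormedSpace ℝ Y] [NormedAddCommGroup Z]
  [NormedSpace ℝ Z] {I : Set ℝ} {V : ℝ × Y → Z} {t : ℝ}

theorem hasFDerivWithinAt_prodMk_left_slab (I : Set ℝ) (t : ℝ) (y : Y) :
    HasFDerivWithinAt (fun s : ℝ => (s, y)) (ContinuousLinearMap.inl ℝ ℝ Y) I t :=
  (hasFDerivAt_prodMk_left t y).hasFDerivWithinAt

theorem hasDerivWithinAt_of_slab {V' : ℝ × Y →L[ℝ] Z} {y : Y}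
    (h : HasFDerivWithinAt V V' (I ×ˢ univ) (t, y)) :
    HasDerivWithinAt (fun s => V (s, y)) (V' (1, 0)) I t := by
  have := h.comp t (hasFDerivWithinAt_prodMk_left_slab I t y) fun s hs => by simpa using hs
  simpa [Function.comp_def] using this.hasDerivWithinAt

theorem hasFDerivAt_of_slab {V' : ℝ × Y →L[ℝ] Z} {y : Y} (ht : t ∈ I)
    (h : HasFDerivWithinAt V V' (I ×ˢ univ) (t, y)) :
    HasFDerivAt (fun y => V (t, y)) (V'.comp (ContinuousLinearMap.inr ℝ ℝ Y)) y := by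
  rw [← hasFDerivWithinAt_univ]
  exact h.comp y (hasFDerivAt_prodMk_right t y).hasFDerivWithinAt fun s _ => by simpa using ht

theorem contDiff_of_slab {n : WithTop ℕ∞} (ht : t ∈ I) (h : ContDiffOn ℝ n V (I ×ˢ univ)) :
    ContDiff ℝ n (fun y => V (t, y)) := by
  rw [← contDiffOn_univ]
  exact h.comp (contDiff_prodMk_right t).contDiffOn fun y _ => by simpa using ht

/-- The total derivative is continuous on the compact set `Icc a b ×ˢ K`, hence bounded there, and
it dominates the derivative in `y`. Convexity of `K` lets the mean value inequality give one
constant for all times. -/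
theorem exists_lipschitzOnWith_of_slab {a b : ℝ} (hab : a < b)
    (h : ContDiffOn ℝ 1 V (Icc a b ×ˢ univ)) {K : Set Y} (hK : IsCompact K) (hc : Convex ℝ K) :
    ∃ C : ℝ≥0, ∀ s ∈ Icc a b, LipschitzOnWith C (fun y => V (s, y)) K := by
  have hu : UniqueDiffOn ℝ (Icc a b ×ˢ (univ : Set Y)) :=
    (uniqueDiffOn_Icc hab).prod uniqueDiffOn_univ
  obtain ⟨C, hC⟩ := (isCompact_Icc.prod hK).exists_bound_of_continuousOn
    ((h.continuousOn_fderivWithin hu le_rfl).mono (prod_mono_right (subset_univ K)))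
  refine ⟨C.toNNReal, fun s hs => ?_⟩
  refine hc.lipschitzOnWith_of_nnnorm_hasFDerivWithin_le (fun y hy =>
    (hasFDerivAt_of_slab hs ((h.differentiableOn one_ne_zero) (s, y)
      ⟨hs, mem_univ _⟩).hasFDerivWithinAt).hasFDerivWithinAt) fun y hy => ?_
  rw [← NNReal.coe_le_coe, coe_nnnorm]
  refine le_trans ?_ (Real.le_coe_toNNReal C)
  refine ContinuousLinearMap.opNorm_le_of_unit_norm
    (le_trans (norm_nonneg _) (hC (s, y) ⟨hs, hy⟩)) fun v hv => ?_
  refine le_trans (ContinuousLinearMap.le_of_opNorm_le _ (hC (s, y) ⟨hs, hy⟩) _) ?_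
  simp [hv]

end Slab

/-- A solution of an ordinary differential equation that exists on the whole time interval and stays
in the ball on which the assumptions of the Picard-Lindelöf theorem hold. -/
theorem exists_integralCurve_mem_closedBall {X : Type*} [NormedAddCommGroup X] [NormedSpace ℝ X]
    [CompleteSpace X] {v : ℝ → X → X} {tmin tmax : ℝ} {t₀ : Icc tmin tmax} {x₀ : X}
    {a L K : ℝ≥0} (hf : IsPicardLindelof v t₀ x₀ a 0 L K) :
    ∃ α : ℝ → X, α t₀ = x₀ ∧ (∀ t, α t ∈ closedBall x₀ a) ∧
      ∀ t ∈ Icc tmin tmax, HasDerivWithinAt α (v t (α t)) (Icc tmin tmax) t := by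
  have hx : x₀ ∈ closedBall x₀ (0 : ℝ≥0) := mem_closedBall_self le_rfl
  -- The fixed point of the Picard map is used directly: membership of its curve in the ball comes
  -- with the function space.
  obtain ⟨α, hα⟩ := ODE.FunSpace.exists_isFixedPt_next hf hx
  refine ⟨α.compProj, by rw [ODE.FunSpace.compProj_val, ← hα, ODE.FunSpace.next_apply₀],
    fun t => α.compProj_mem_closedBall hf.mul_max_le, fun t ht ↦ ?_⟩
  apply ODE.hasDerivWithinAt_picard_Icc t₀.2 hf.continuousOn_uncurry
    α.continuous_compProj.continuousOn (fun _ ht' ↦ α.compProj_mem_closedBall hf.mul_max_le)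
    x₀ ht |>.congr_of_mem _ ht
  intro t' ht'
  nth_rw 1 [← hα]
  rw [ODE.FunSpace.compProj_of_mem ht', ODE.FunSpace.next_apply]

/-! ### Characteristics -/

/-- Lets the analysis run on compact intervals. Time derivatives within the smaller set agree with
the original ones by differentiability and uniqueness of derivatives. -/
theorem IsClassicalSolution.mono {I J : Set ℝ} {f : ℝ → R3 → R3 → ℝ} {E B : ℝ → R3 → R3}
    (h : IsClassicalSolution I f E B) (hJI : J ⊆ I) (hJ : UniqueDiffOn ℝ J) :
    IsClassicalSolution J f E B where
  contDiffOn_f := h.contDiffOn_f.mono (prod_mono_left hJI)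
  contDiffOn_E := h.contDiffOn_E.mono (prod_mono_left hJI)
  contDiffOn_B := h.contDiffOn_B.mono (prod_mono_left hJI)
  vlasov t ht x p := by
    have := h.vlasov t (hJI ht) x p
    rwa [derivWithin_subset hJI (hJ t ht)]
    exact (hasDerivWithinAt_of_slab ((h.contDiffOn_f.differentiableOn one_ne_zero) (t, x, p)
      ⟨hJI ht, mem_univ _⟩).hasFDerivWithinAt).differentiableWithinAt
  ampere t ht x := by
    have := h.ampere t (hJI ht) x
    rwa [derivWithin_subset hJI (hJ t ht)]
    exact (hasDerivWithinAt_of_slab ((h.contDiffOn_E.differentiableOn one_ne_zero) (t, x)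
      ⟨hJI ht, mem_univ _⟩).hasFDerivWithinAt).differentiableWithinAt
  faraday t ht x := by
    have := h.faraday t (hJI ht) x
    rwa [derivWithin_subset hJI (hJ t ht)]
    exact (hasDerivWithinAt_of_slab ((h.contDiffOn_B.differentiableOn one_ne_zero) (t, x)
      ⟨hJI ht, mem_univ _⟩).hasFDerivWithinAt).differentiableWithinAt
  gauss t ht := h.gauss t (hJI ht)
  div_B t ht := h.div_B t (hJI ht)

namespace IsClassicalSolution

variable {a b t : ℝ} {f : ℝ → R3 → R3 → ℝ} {E B : ℝ → R3 → R3}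

/-- The Vlasov equation in terms of the total derivative of the density. -/
theorem fderivWithin_characteristic {I : Set ℝ} (h : IsClassicalSolution I f E B)
    (hI : UniqueDiffOn ℝ I) (ht : t ∈ I) (x p : R3) :
    fderivWithin ℝ (fun z : ℝ × R3 × R3 => f z.1 z.2.1 z.2.2) (I ×ˢ univ) (t, x, p)
      (1, vel p, E t x + cross (vel p) (B t x)) = 0 := by
  have hd := ((h.contDiffOn_f.differentiableOn one_ne_zero) (t, x, p)
      ⟨ht, mem_univ _⟩).hasFDerivWithinAt
  set V' := fderivWithin ℝ (fun z : ℝ × R3 × R3 => f z.1 z.2.1 z.2.2) (I ×ˢ univ) (t, x, p)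
  have h1 := hasDerivWithinAt_of_slab hd
  have h2 := hasFDerivAt_of_slab ht hd
  have h3 := HasFDerivAt.comp x h2 (hasFDerivAt_prodMk_left (𝕜 := ℝ) x p)
  have h4 := HasFDerivAt.comp p h2 (hasFDerivAt_prodMk_right (𝕜 := ℝ) x p)
  have hv := h.vlasov t ht x p
  simp only [Function.comp_def] at h1 h3 h4
  rw [h1.derivWithin (hI t ht), h3.fderiv, h4.fderiv] at hv
  simp only [ContinuousLinearMap.comp_apply, ContinuousLinearMap.inl_apply,
    ContinuousLinearMap.inr_apply, ← map_add] at hv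
  simpa using hv

/-- Along characteristics the density is constant, positions move at most at the speed of light and
momenta change at a rate bounded by the fields. -/
theorem exists_eq_initial (h : IsClassicalSolution (Icc a b) f E B) (hab : a < b)
    (h0 : (0 : ℝ) ∈ Icc a b) (ht : t ∈ Icc a b) (x₀ p₀ : R3) {l : ℝ} (hl : 0 < l)
    (hbound : ∀ s ∈ Icc a b, ∀ x, ‖x - x₀‖ ≤ b - a → ‖E s x‖ + ‖B s x‖ ≤ l) :
    ∃ x p, f t x₀ p₀ = f 0 x p ∧ ‖x - x₀‖ ≤ b - a ∧ ‖p - p₀‖ ≤ l * (b - a) := by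
  have hT : 0 ≤ b - a := by linarith
  -- Momentum is measured in units of `l`. Both components of the characteristic field then have
  -- norm at most `1` wherever the field bound holds, so a single ball of radius `b - a` serves for
  -- position and momentum.
  let W : ℝ × R3 × R3 → R3 × R3 := fun z =>
    (vel (l • z.2.2), l⁻¹ • (E z.1 z.2.1 + cross (vel (l • z.2.2)) (B z.1 z.2.1)))
  have hsnd : ContDiff ℝ 1 (fun z : ℝ × R3 × R3 => vel (l • z.2.2)) :=
    contDiff_vel.comp (by fun_prop)
  have hproj : ContDiff ℝ 1 (fun z : ℝ × R3 × R3 => (z.1, z.2.1)) := by fun_prop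
  have hmaps : MapsTo (fun z : ℝ × R3 × R3 => (z.1, z.2.1)) (Icc a b ×ˢ univ)
      (Icc a b ×ˢ univ) := fun z hz => ⟨hz.1, mem_univ _⟩
  have hE : ContDiffOn ℝ 1 (fun z : ℝ × R3 × R3 => E z.1 z.2.1) (Icc a b ×ˢ univ) :=
    h.contDiffOn_E.comp hproj.contDiffOn hmaps
  have hB : ContDiffOn ℝ 1 (fun z : ℝ × R3 × R3 => B z.1 z.2.1) (Icc a b ×ˢ univ) :=
    h.contDiffOn_B.comp hproj.contDiffOn hmaps
  have hW : ContDiffOn ℝ 1 W (Icc a b ×ˢ univ) :=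
    hsnd.contDiffOn.prodMk (ContDiffOn.const_smul l⁻¹
      (hE.add (contDiff_cross.comp_contDiffOn (hsnd.contDiffOn.prodMk hB))))
  obtain ⟨K, hK⟩ := exists_lipschitzOnWith_of_slab hab hW
    (isCompact_closedBall (x₀, l⁻¹ • p₀) (b - a)) (convex_closedBall _ _)
  have hpl : IsPicardLindelof (fun s y => W (s, y)) ⟨t, ht⟩ (x₀, l⁻¹ • p₀)
      ⟨b - a, hT⟩ 0 1 K := by
    refine ⟨hK, fun y _ => ?_, fun s hs y hy => ?_, ?_⟩
    · exact hW.continuousOn.comp (by fun_prop) fun s hs => ⟨hs, mem_univ _⟩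
    · have hy1 : ‖y.1 - x₀‖ ≤ b - a := by
        rw [mem_closedBall, dist_eq_norm] at hy
        exact (norm_fst_le (y - (x₀, l⁻¹ • p₀))).trans hy
      have := hbound s hs _ hy1
      rw [NNReal.coe_one, Prod.norm_def, max_le_iff]
      refine ⟨norm_vel_le _, ?_⟩
      rw [norm_smul, norm_inv, Real.norm_of_nonneg hl.le, inv_mul_le_iff₀ hl, mul_one]
      refine (norm_add_le _ _).trans (le_trans ?_ this)
      gcongr
      refine (norm_cross_le _ _).trans ?_
      nlinarith [norm_vel_le (l • y.2), norm_nonneg (B s y.1)]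
    -- At speed at most `1` a curve started at the centre cannot leave the ball of radius `b - a`
    -- within the interval, so the solution exists on all of it.
    · simp only [NNReal.coe_one, one_mul, NNReal.coe_zero, sub_zero]
      change max (b - t) (t - a) ≤ b - a
      exact max_le (by linarith [ht.1]) (by linarith [ht.2])
  obtain ⟨α, hα0, hαb, hα⟩ := exists_integralCurve_mem_closedBall hpl
  simp only at hα0
  have hg : ∀ s ∈ Icc a b, HasDerivWithinAt (fun s => f s (α s).1 (l • (α s).2)) 0 (Icc a b) s := by
    intro s hs
    have hd := ((h.contDiffOn_f.differentiableOn one_ne_zero) (s, (α s).1, l • (α s).2)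
      ⟨hs, mem_univ _⟩).hasFDerivWithinAt
    have h1 : HasDerivWithinAt (fun s => (α s).1) (W (s, α s)).1 (Icc a b) s :=
      (ContinuousLinearMap.fst ℝ R3 R3).hasFDerivAt.comp_hasDerivWithinAt s (hα s hs)
    have h2 : HasDerivWithinAt (fun s => (α s).2) (W (s, α s)).2 (Icc a b) s :=
      (ContinuousLinearMap.snd ℝ R3 R3).hasFDerivAt.comp_hasDerivWithinAt s (hα s hs)
    have hc : HasDerivWithinAt (fun s => (s, (α s).1, l • (α s).2))
        (1, (W (s, α s)).1, l • (W (s, α s)).2) (Icc a b) s :=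
      (hasDerivWithinAt_id s (Icc a b)).prodMk (h1.prodMk (h2.const_smul l))
    have := hd.comp_hasDerivWithinAt s hc fun s hs => mk_mem_prod hs (mem_univ _)
    have hz := h.fderivWithin_characteristic (uniqueDiffOn_Icc hab) hs (α s).1 (l • (α s).2)
    -- Undoing the rescaling makes the velocity of the curve the characteristic direction, along
    -- which the total derivative of `f` vanishes.
    have hl2 : l • (W (s, α s)).2 =
        E s (α s).1 + cross (vel (l • (α s).2)) (B s (α s).1) := by
      simp only [W, smul_smul, mul_inv_cancel₀ hl.ne', one_smul]
    rw [hl2, hz] at this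
    exact this
  have hconst : ∀ s ∈ Icc a b, f s (α s).1 (l • (α s).2) = f a (α a).1 (l • (α a).2) :=
    constant_of_derivWithin_zero (fun s hs => (hg s hs).differentiableWithinAt)
      fun s hs => (hg s (Ico_subset_Icc_self hs)).derivWithin
        (uniqueDiffOn_Icc hab s (Ico_subset_Icc_self hs))
  have hb : ‖α 0 - (x₀, l⁻¹ • p₀)‖ ≤ b - a := mem_closedBall_iff_norm.1 (hαb 0)
  refine ⟨(α 0).1, l • (α 0).2, ?_, (norm_fst_le (α 0 - (x₀, l⁻¹ • p₀))).trans hb, ?_⟩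
  · rw [hconst 0 h0, ← hconst t ht, hα0]
    simp [smul_smul, mul_inv_cancel₀ hl.ne']
  · have h2 : ‖(α 0).2 - l⁻¹ • p₀‖ ≤ b - a := (norm_snd_le (α 0 - (x₀, l⁻¹ • p₀))).trans hb
    calc ‖l • (α 0).2 - p₀‖ = ‖l • ((α 0).2 - l⁻¹ • p₀)‖ := by
          rw [smul_sub, smul_smul, mul_inv_cancel₀ hl.ne', one_smul]
      _ = l * ‖(α 0).2 - l⁻¹ • p₀‖ := by rw [norm_smul, Real.norm_of_nonneg hl.le]
      _ ≤ l * (b - a) := by gcongr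

theorem exists_field_bound (h : IsClassicalSolution (Icc a b) f E B) (r : ℝ) :
    ∃ l > 0, ∀ s ∈ Icc a b, ∀ x, ‖x‖ ≤ r → ‖E s x‖ + ‖B s x‖ ≤ l := by
  have key (F : ℝ → R3 → R3)
      (hF : ContinuousOn (fun z : ℝ × R3 => F z.1 z.2) (Icc a b ×ˢ univ)) :
      ∃ C, ∀ s ∈ Icc a b, ∀ x, ‖x‖ ≤ r → ‖F s x‖ ≤ C := by
    obtain ⟨C, hC⟩ := (isCompact_Icc.prod
      (isCompact_closedBall (0 : R3) r)).exists_bound_of_continuousOn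
      (hF.mono (prod_mono_right (subset_univ _)))
    exact ⟨C, fun s hs x hx => hC (s, x) ⟨hs, by simpa using hx⟩⟩
  obtain ⟨C, hC⟩ := key E h.contDiffOn_E.continuousOn
  obtain ⟨D, hD⟩ := key B h.contDiffOn_B.continuousOn
  exact ⟨max (C + D) 1, lt_max_of_lt_right one_pos, fun s hs x hx =>
    le_max_of_le_left (add_le_add (hC s hs x hx) (hD s hs x hx))⟩

/-- The field bound `l` depends on `x₀`, but the displacement in position does not involve `l`, so
this estimate is uniform in the point. -/
theorem exists_eq_initial_position (h : IsClassicalSolution (Icc a b) f E B) (hab : a < b)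
    (h0 : (0 : ℝ) ∈ Icc a b) (ht : t ∈ Icc a b) (x₀ p₀ : R3) :
    ∃ x p, f t x₀ p₀ = f 0 x p ∧ ‖x - x₀‖ ≤ b - a := by
  obtain ⟨l, hl, hb⟩ := h.exists_field_bound (‖x₀‖ + (b - a))
  obtain ⟨x, p, h1, h2, -⟩ := h.exists_eq_initial hab h0 ht x₀ p₀ hl fun s hs x hx =>
    hb s hs x (by linarith [norm_sub_norm_le x x₀])
  exact ⟨x, p, h1, h2⟩

/-- On a compact time interval the density vanishes outside a fixed compact set. -/
theorem exists_support_bound (h : IsClassicalSolution (Icc a b) f E B) (hab : a < b)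
    (h0 : (0 : ℝ) ∈ Icc a b) (hc : HasCompactSupport (fun z : R3 × R3 => f 0 z.1 z.2)) :
    ∃ R, ∀ s ∈ Icc a b, ∀ x p, f s x p ≠ 0 → ‖x‖ ≤ R ∧ ‖p‖ ≤ R := by
  obtain ⟨R₀, hR₀⟩ := hc.isCompact.isBounded.exists_norm_le
  have key : ∀ x p, f 0 x p ≠ 0 → ‖x‖ ≤ R₀ ∧ ‖p‖ ≤ R₀ := fun x p hxp => by
    have := hR₀ (x, p) (subset_tsupport _ hxp)
    exact ⟨(norm_fst_le _).trans this, (norm_snd_le _).trans this⟩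
  -- Positions in the support stay within `R₀ + (b - a)`, and a characteristic through such a point
  -- moves by at most `b - a` more. One field bound on this ball therefore controls all relevant
  -- momenta.
  obtain ⟨l, hl, hb⟩ := h.exists_field_bound (R₀ + 2 * (b - a))
  refine ⟨max (R₀ + (b - a)) (R₀ + l * (b - a)), fun s hs x p hxp => ?_⟩
  have hx : ‖x‖ ≤ R₀ + (b - a) := by
    obtain ⟨x', p', h1, h2⟩ := h.exists_eq_initial_position hab h0 hs x p
    have := (key x' p' (h1 ▸ hxp)).1
    rw [norm_sub_rev] at h2
    linarith [norm_sub_norm_le x x']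
  obtain ⟨x', p', h1, -, h2⟩ := h.exists_eq_initial hab h0 hs x p hl fun s hs y hy =>
    hb s hs y (by linarith [norm_sub_norm_le y x])
  have := (key x' p' (h1 ▸ hxp)).2
  rw [norm_sub_rev] at h2
  exact ⟨le_max_of_le_left hx, le_max_of_le_right (by linarith [norm_sub_norm_le p p'])⟩

end IsClassicalSolution

/-! ### Integration by parts -/

section Parts

variable {Y : Type*} [NormedAddCommGroup Y] [NormedSpace ℝ Y] [FiniteDimensional ℝ Y]
  [MeasurableSpace Y] [BorelSpace Y] {μ : Measure Y} [μ.IsAddHaarMeasure]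

theorem integral_mul_fderiv_eq_neg {u g : Y → ℝ} (hu : ContDiff ℝ 1 u) (hg : ContDiff ℝ 1 g)
    (hc : HasCompactSupport g) (v : Y) :
    ∫ y, u y * fderiv ℝ g y v ∂μ = -∫ y, fderiv ℝ u y v * g y ∂μ := by
  have hu' : Continuous (fun y => fderiv ℝ u y v) :=
    (hu.continuous_fderiv one_ne_zero).clm_apply continuous_const
  have hg' : Continuous (fun y => fderiv ℝ g y v) :=
    (hg.continuous_fderiv one_ne_zero).clm_apply continuous_const
  apply integral_mul_fderiv_eq_neg_fderiv_mul_of_integrable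
  · exact (hu'.mul hg.continuous).integrable_of_hasCompactSupport hc.mul_left
  · exact (hu.continuous.mul hg').integrable_of_hasCompactSupport
      (hc.fderiv_apply (𝕜 := ℝ) v).mul_left
  · exact (hu.continuous.mul hg.continuous).integrable_of_hasCompactSupport hc.mul_left
  · exact fun x _ => hu.differentiable one_ne_zero x
  · exact fun x _ => hg.differentiable one_ne_zero x

end Parts

theorem eq_sum_single (v : R3) : v = ∑ i, v i • EuclideanSpace.single i (1 : ℝ) := by
  ext j
  simp [Finset.sum_apply, Pi.single_apply]

theorem cross_add_left (u u' v : R3) : cross (u + u') v = cross u v + cross u' v := by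
  simp [cross]

theorem cross_eq_sum (p b : R3) :
    cross p b = ∑ i, p i • cross (EuclideanSpace.single i (1 : ℝ)) b := by
  conv_lhs => rw [eq_sum_single p]
  simp only [Fin.sum_univ_three, cross_add_left, cross_smul_left]

theorem cross_single_apply_self (i : Fin 3) (b : R3) :
    cross (EuclideanSpace.single i (1 : ℝ)) b i = 0 := by
  fin_cases i <;> simp [cross_apply_zero, cross_apply_one, cross_apply_two]

/-- The force field has no divergence in the momentum variable, so that only the power of the
electric field is left after an integration by parts. -/
theorem integral_gam_mul_fderiv_force {g : R3 → ℝ} (hg : ContDiff ℝ 1 g)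
    (hc : HasCompactSupport g) (e b : R3) :
    ∫ p, gam p * fderiv ℝ g p (e + cross (vel p) b) = -∫ p, inner ℝ (vel p) e * g p := by
  have hcoord (i : Fin 3) : ContDiff ℝ 1 (fun p : R3 => p i) :=
    (contDiff_euclidean.1 contDiff_id) i
  have hg' (v : R3) : Continuous (fun y => fderiv ℝ g y v) :=
    (hg.continuous_fderiv one_ne_zero).clm_apply continuous_const
  have hint (u : R3 → ℝ) (hu : Continuous u) (v : R3) :
      Integrable (fun p => u p * fderiv ℝ g p v) :=
    (hu.mul (hg' v)).integrable_of_hasCompactSupport (hc.fderiv_apply (𝕜 := ℝ) v).mul_left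
  -- After integration by parts the derivative falls on `p i` in the direction `eᵢ × b`, which has
  -- no `i`-th component.
  have hmag (i : Fin 3) :
      ∫ p : R3, p i * fderiv ℝ g p (cross (EuclideanSpace.single i (1 : ℝ)) b) = 0 := by
    rw [integral_mul_fderiv_eq_neg (hcoord i) hg hc]
    have : ∀ p : R3, fderiv ℝ (fun p : R3 => p i) p
        (cross (EuclideanSpace.single i (1 : ℝ)) b) = 0 := fun p => by
      have h : HasFDerivAt (fun p : R3 => p i) (EuclideanSpace.proj i : R3 →L[ℝ] ℝ) p :=
        (EuclideanSpace.proj i : R3 →L[ℝ] ℝ).hasFDerivAt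
      rw [h.fderiv]
      exact cross_single_apply_self i b
    simp [this]
  -- Since `gam p • vel p = p`, the weight turns the magnetic force into `p × b`, which is linear in
  -- `p`.
  have hpt : ∀ p, gam p * fderiv ℝ g p (e + cross (vel p) b) = gam p * fderiv ℝ g p e +
      ∑ i, p i * fderiv ℝ g p (cross (EuclideanSpace.single i (1 : ℝ)) b) := fun p => by
    rw [map_add, mul_add]
    congr 1
    rw [← smul_eq_mul, ← map_smul, ← cross_smul_left, gam_smul_vel, cross_eq_sum, map_sum]
    simp
  simp_rw [hpt]
  rw [integral_add (hint _ contDiff_gam.continuous e)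
    (integrable_finsetSum _ fun i _ => hint _ (hcoord i).continuous _),
    integral_finsetSum _ fun i _ => hint _ (hcoord i).continuous _]
  simp only [hmag, Finset.sum_const_zero, add_zero]
  rw [integral_mul_fderiv_eq_neg contDiff_gam hg hc]
  simp_rw [fderiv_gam]

theorem pd_eq_fderiv_apply {F : R3 → R3} {x : R3} (hF : DifferentiableAt ℝ F x) (i k : Fin 3) :
    pd F i k x = fderiv ℝ (fun y => F y k) x (EuclideanSpace.single i 1) := by
  have h : HasFDerivAt (fun y => F y k)
      ((EuclideanSpace.proj k : R3 →L[ℝ] ℝ).comp (fderiv ℝ F x)) x :=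
    (EuclideanSpace.proj k : R3 →L[ℝ] ℝ).hasFDerivAt.comp x hF.hasFDerivAt
  rw [h.fderiv]
  rfl

/-- This is `div (F × G) = G · curl F - F · curl G`, expanded in coordinates with the product rule.
-/
theorem inner_curl_sub_inner_curl {F G : R3 → R3} {x : R3} (hF : DifferentiableAt ℝ F x)
    (hG : DifferentiableAt ℝ G x) :
    inner ℝ (F x) (curl G x) - inner ℝ (G x) (curl F x) =
      -∑ i, fderiv ℝ (fun y => cross (F y) (G y) i) x (EuclideanSpace.single i 1) := by
  have hf (k : Fin 3) : HasFDerivAt (fun y => F y k) (fderiv ℝ (fun y => F y k) x) x :=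
    ((EuclideanSpace.proj k : R3 →L[ℝ] ℝ).differentiableAt.comp x hF).hasFDerivAt
  have hg (k : Fin 3) : HasFDerivAt (fun y => G y k) (fderiv ℝ (fun y => G y k) x) x :=
    ((EuclideanSpace.proj k : R3 →L[ℝ] ℝ).differentiableAt.comp x hG).hasFDerivAt
  have h (i j k l : Fin 3) := (((hf i).mul (hg j)).sub ((hf k).mul (hg l))).fderiv
  simp only [Pi.mul_def, Pi.sub_def] at h
  simp only [Fin.sum_univ_three, cross_apply_zero, cross_apply_one, cross_apply_two, h]
  simp only [curl, pd_eq_fderiv_apply hF, pd_eq_fderiv_apply hG, PiLp.inner_apply,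
    Fin.sum_univ_three]
  simp
  ring

/-- Poynting's identity, integrated against a compactly supported weight. -/
theorem integral_mul_inner_curl {F G : R3 → R3} {w : R3 → ℝ} (hF : ContDiff ℝ 1 F)
    (hG : ContDiff ℝ 1 G) (hw : ContDiff ℝ 1 w) (hc : HasCompactSupport w) :
    ∫ x, w x * (inner ℝ (F x) (curl G x) - inner ℝ (G x) (curl F x)) =
      ∫ x, fderiv ℝ w x (cross (F x) (G x)) := by
  have hH (i : Fin 3) : ContDiff ℝ 1 (fun y => cross (F y) (G y) i) :=
    (contDiff_euclidean.1 (contDiff_cross.comp (hF.prodMk hG))) i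
  have hH' (i : Fin 3) : Continuous (fun y => fderiv ℝ (fun y => cross (F y) (G y) i) y
      (EuclideanSpace.single i 1)) :=
    ((hH i).continuous_fderiv one_ne_zero).clm_apply continuous_const
  have hw' (v : R3) : Continuous (fun y => fderiv ℝ w y v) :=
    (hw.continuous_fderiv one_ne_zero).clm_apply continuous_const
  have hL : ∀ x, w x * (inner ℝ (F x) (curl G x) - inner ℝ (G x) (curl F x)) =
      ∑ i, -(fderiv ℝ (fun y => cross (F y) (G y) i) x (EuclideanSpace.single i 1) * w x) := by
    intro x
    rw [inner_curl_sub_inner_curl (hF.differentiable one_ne_zero x)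
      (hG.differentiable one_ne_zero x), mul_neg, mul_comm, Finset.sum_mul, Finset.sum_neg_distrib]
  have hR : ∀ x, fderiv ℝ w x (cross (F x) (G x)) =
      ∑ i, cross (F x) (G x) i * fderiv ℝ w x (EuclideanSpace.single i 1) := by
    intro x
    conv_lhs => rw [eq_sum_single (cross (F x) (G x))]
    simp
  simp_rw [hL, hR]
  rw [integral_finsetSum, integral_finsetSum]
  · refine Finset.sum_congr rfl fun i _ => ?_
    rw [integral_neg, integral_mul_fderiv_eq_neg (hH i) hw hc]
  · exact fun i _ => ((hH i).continuous.mul (hw' _)).integrable_of_hasCompactSupport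
      (hc.fderiv_apply (𝕜 := ℝ) _).mul_left
  · exact fun i _ => (((hH' i).mul hw.continuous).integrable_of_hasCompactSupport hc.mul_left).neg

/-! ### Integrals depending on time -/

section Slab

variable {Y : Type*} [NormedAddCommGroup Y] [NormedSpace ℝ Y] [MeasurableSpace Y] [BorelSpace Y]
  {μ : Measure Y} [IsFiniteMeasureOnCompacts μ] {U : ℝ × Y → ℝ} {a b : ℝ} {K : Set Y}

theorem hasDerivAt_integral_of_slab [SecondCountableTopology Y]
    (hU : ContDiffOn ℝ 1 U (Icc a b ×ˢ univ)) (hK : IsCompact K)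
    (h0 : ∀ s ∈ Icc a b, ∀ y ∉ K, U (s, y) = 0) {t : ℝ} (ht : t ∈ Ioo a b) {U' : Y → ℝ}
    (hU' : ∀ y, HasDerivAt (fun s => U (s, y)) (U' y) t) :
    HasDerivAt (fun s => ∫ y, U (s, y) ∂μ) (∫ y, U' y ∂μ) t := by
  have hab : a < b := ht.1.trans ht.2
  have hu : UniqueDiffOn ℝ (Icc a b ×ˢ (univ : Set Y)) :=
    (uniqueDiffOn_Icc hab).prod uniqueDiffOn_univ
  set D : ℝ → Y → ℝ := fun s y => fderivWithin ℝ U (Icc a b ×ˢ univ) (s, y) (1, 0) with hD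
  have hDc : ContinuousOn (fun z : ℝ × Y => D z.1 z.2) (Icc a b ×ˢ univ) :=
    (hU.continuousOn_fderivWithin hu le_rfl).clm_apply continuousOn_const
  have hDd : ∀ s ∈ Ioo a b, ∀ y, HasDerivAt (fun s => U (s, y)) (D s y) s := fun s hs y =>
    (hasDerivWithinAt_of_slab ((hU.differentiableOn one_ne_zero) (s, y)
      ⟨Ioo_subset_Icc_self hs, mem_univ _⟩).hasFDerivWithinAt).hasDerivAt (Icc_mem_nhds hs.1 hs.2)
  have hslice : ∀ {V : ℝ × Y → ℝ}, ContinuousOn V (Icc a b ×ˢ univ) → ∀ s ∈ Icc a b,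
      Continuous (fun y => V (s, y)) := fun hV s hs =>
    continuousOn_univ.1 (hV.comp (by fun_prop) fun y _ => ⟨hs, mem_univ _⟩)
  have hUe : U' = D t := funext fun y => (hU' y).unique (hDd t ht y)
  obtain ⟨C, hC⟩ := (isCompact_Icc.prod hK).exists_bound_of_continuousOn
    (hDc.mono (prod_mono_right (subset_univ K)))
  rw [hUe]
  refine (hasDerivAt_integral_of_dominated_loc_of_deriv_le (bound := K.indicator fun _ => C)
    (Ioo_mem_nhds ht.1 ht.2) ?_ ?_ ?_ ?_ ?_ ?_).2
  · filter_upwards [Ioo_mem_nhds ht.1 ht.2] with s hs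
    exact (hslice hU.continuousOn s (Ioo_subset_Icc_self hs)).aestronglyMeasurable
  · exact (hslice hU.continuousOn t (Ioo_subset_Icc_self ht)).integrable_of_hasCompactSupport
      (HasCompactSupport.intro hK (h0 t (Ioo_subset_Icc_self ht)))
  · exact (hslice hDc t (Ioo_subset_Icc_self ht)).aestronglyMeasurable
  · refine Filter.Eventually.of_forall fun y s hs => ?_
    by_cases hy : y ∈ K
    · rw [indicator_of_mem hy]
      exact hC (s, y) ⟨Ioo_subset_Icc_self hs, hy⟩
    -- Off `K` the integrand is zero for all times in the interval, so its time derivative vanishes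
    -- as well.
    · rw [indicator_of_notMem hy]
      have h1 : HasDerivAt (fun s => U (s, y)) 0 s :=
        (hasDerivAt_const s (0 : ℝ)).congr_of_eventuallyEq <| by
          filter_upwards [Ioo_mem_nhds hs.1 hs.2] with r hr
          exact h0 r (Ioo_subset_Icc_self hr) y hy
      simp [(hDd s hs y).unique h1]
  · exact (integrable_indicator_iff hK.measurableSet).2
      (integrableOn_const hK.measure_lt_top.ne)
  · exact Filter.Eventually.of_forall fun y s hs => hDd s hs y

end Slab

/-! ### Weights that are monotone along light cones -/

/-- A smooth nonincreasing function equal to `1` up to `S` and to `0` from `S + 1` on. -/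
def cutoff (S s : ℝ) : ℝ := Real.smoothTransition (S + 1 - s)

theorem contDiff_cutoff (S : ℝ) : ContDiff ℝ 1 (cutoff S) :=
  Real.smoothTransition.contDiff.comp (contDiff_const.sub contDiff_id)

theorem cutoff_antitone (S : ℝ) : Antitone (cutoff S) := fun s t hst =>
  Real.smoothTransition.monotone (by linarith)

/-- A space-time weight whose level sets are smoothed light cones, narrowing in time for
`σ = 1` and widening for `σ = -1`. -/
def weight (S σ s : ℝ) (x : R3) : ℝ := cutoff S (gam x + σ * s)

/-- The derivative of the profile of `weight`. -/
def weightSlope (S σ s : ℝ) (x : R3) : ℝ := deriv (cutoff S) (gam x + σ * s)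

section Weight

variable {S σ s : ℝ} {x : R3}

theorem weight_nonneg : 0 ≤ weight S σ s x := Real.smoothTransition.nonneg _

theorem weight_le_one : weight S σ s x ≤ 1 := Real.smoothTransition.le_one _

theorem weight_eq_one (h : gam x + σ * s ≤ S) : weight S σ s x = 1 :=
  Real.smoothTransition.one_of_one_le (by linarith)

theorem weight_eq_zero (h : S + 1 ≤ gam x + σ * s) : weight S σ s x = 0 :=
  Real.smoothTransition.zero_of_nonpos (by linarith)

theorem weightSlope_nonpos : weightSlope S σ s x ≤ 0 := (cutoff_antitone S).deriv_nonpos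

theorem contDiff_weight (S σ : ℝ) : ContDiff ℝ 1 (fun z : ℝ × R3 => weight S σ z.1 z.2) := by
  have h : ContDiff ℝ 1 (fun z : ℝ × R3 => gam z.2 + σ * z.1) :=
    (contDiff_gam.comp contDiff_snd).add (by fun_prop)
  exact (contDiff_cutoff S).comp h

theorem contDiff_weight_slice (S σ s : ℝ) : ContDiff ℝ 1 (weight S σ s) :=
  (contDiff_cutoff S).comp (contDiff_gam.add contDiff_const)

theorem continuous_weightSlope (S σ s : ℝ) : Continuous (weightSlope S σ s) :=
  ((contDiff_cutoff S).continuous_deriv le_rfl).comp (contDiff_gam.continuous.add continuous_const)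

theorem hasDerivAt_weight (S σ s : ℝ) (x : R3) :
    HasDerivAt (fun s => weight S σ s x) (σ * weightSlope S σ s x) s := by
  have h1 : HasDerivAt (fun s => gam x + σ * s) σ s := by
    simpa using ((hasDerivAt_id s).const_mul σ).const_add (gam x)
  have h2 := ((contDiff_cutoff S).differentiable one_ne_zero (gam x + σ * s)).hasDerivAt
  rw [mul_comm]
  exact h2.comp s h1

/-- The gradient is the slope times `vel x`, and the time derivative is the slope times `σ`. As
`‖vel x‖ ≤ 1`, the time derivative dominates any transport at speed at most `1`. -/
theorem fderiv_weight (S σ s : ℝ) (x v : R3) :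
    fderiv ℝ (weight S σ s) x v = weightSlope S σ s x * inner ℝ (vel x) v := by
  have h1 : HasFDerivAt (fun x => gam x + σ * s) (fderiv ℝ gam x) x :=
    (contDiff_gam.differentiable one_ne_zero x).hasFDerivAt.add_const _
  have h2 := ((contDiff_cutoff S).differentiable one_ne_zero (gam x + σ * s)).hasDerivAt
  have h3 : HasFDerivAt (weight S σ s) _ x := h2.comp_hasFDerivAt x h1
  rw [h3.fderiv, smul_apply, fderiv_gam, smul_eq_mul, weightSlope]

/-- The profile attains its minimum value `0` there, which also covers the edge `S + 1` itself. -/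
theorem weightSlope_eq_zero (h : S + 1 ≤ gam x + σ * s) : weightSlope S σ s x = 0 := by
  refine IsLocalMin.deriv_eq_zero (Filter.Eventually.of_forall fun r => ?_)
  rw [show cutoff S (gam x + σ * s) = 0 from weight_eq_zero h]
  exact Real.smoothTransition.nonneg _

/-- On a bounded time interval containing `0` the weights vanish outside a fixed ball. -/
theorem le_of_notMem_closedBall {a b : ℝ} (hσ : |σ| = 1) (h0 : (0 : ℝ) ∈ Icc a b)
    (hs : s ∈ Icc a b) (hx : x ∉ closedBall (0 : R3) (S + 1 + (b - a))) :
    S + 1 ≤ gam x + σ * s := by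
  rw [mem_closedBall_zero_iff, not_le] at hx
  have h1 : |σ * s| ≤ b - a := by
    rw [abs_mul, hσ, one_mul, abs_le]
    constructor <;> linarith [h0.1, h0.2, hs.1, hs.2]
  linarith [norm_lt_gam x, neg_abs_le (σ * s)]

end Weight

/-! ### The transport terms -/

section Transport

variable {g : R3 × R3 → ℝ} {w : R3 → ℝ}

theorem fderiv_slice_fst (hg : ContDiff ℝ 1 g) (x p v : R3) :
    fderiv ℝ (fun y => g (y, p)) x v = fderiv ℝ g (x, p) (v, 0) := by
  have h := HasFDerivAt.comp x (hg.differentiable one_ne_zero (x, p)).hasFDerivAt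
    (hasFDerivAt_prodMk_left (𝕜 := ℝ) x p)
  simp only [Function.comp_def] at h
  rw [h.fderiv]
  simp

theorem fderiv_slice_snd (hg : ContDiff ℝ 1 g) (x p v : R3) :
    fderiv ℝ (fun q => g (x, q)) p v = fderiv ℝ g (x, p) (0, v) := by
  have h := HasFDerivAt.comp p (hg.differentiable one_ne_zero (x, p)).hasFDerivAt
    (hasFDerivAt_prodMk_right (𝕜 := ℝ) x p)
  simp only [Function.comp_def] at h
  rw [h.fderiv]
  simp

theorem hasCompactSupport_slice_fst (hc : HasCompactSupport g) (p : R3) :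
    HasCompactSupport (fun y => g (y, p)) :=
  HasCompactSupport.intro (hc.isCompact.image continuous_fst) fun y hy => by
    by_contra hne
    exact hy ⟨(y, p), subset_tsupport _ hne, rfl⟩

theorem hasCompactSupport_slice_snd (hc : HasCompactSupport g) (x : R3) :
    HasCompactSupport (fun q => g (x, q)) :=
  HasCompactSupport.intro (hc.isCompact.image continuous_snd) fun q hq => by
    by_contra hne
    exact hq ⟨(x, q), subset_tsupport _ hne, rfl⟩

theorem continuous_fderiv_apply_of_contDiff (hg : ContDiff ℝ 1 g) {V : R3 × R3 → R3 × R3}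
    (hV : Continuous V) : Continuous (fun z => fderiv ℝ g z (V z)) :=
  (hg.continuous_fderiv one_ne_zero).clm_apply hV

theorem hasCompactSupport_fderiv_apply (hc : HasCompactSupport g) (V : R3 × R3 → R3 × R3) :
    HasCompactSupport (fun z => fderiv ℝ g z (V z)) :=
  (hc.fderiv (𝕜 := ℝ)).mono fun z hz hz' => hz (by simp [hz'])

/-- At fixed `p` the velocity is a constant direction, so an integration by parts in `x` moves the
derivative onto the weight. -/
theorem integral_transport_position (hg : ContDiff ℝ 1 g) (hc : HasCompactSupport g)
    (hw : ContDiff ℝ 1 w) :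
    ∫ z : R3 × R3, w z.1 * gam z.2 * fderiv ℝ g z (vel z.2, 0) =
      -∫ z : R3 × R3, fderiv ℝ w z.1 (vel z.2) * gam z.2 * g z := by
  have hgam := contDiff_gam.continuous
  have hvel := contDiff_vel.continuous
  have hwc := hw.continuous
  have hgc := hg.continuous
  have hw' : Continuous (fun z : R3 × R3 => fderiv ℝ w z.1 (vel z.2)) :=
    ((hw.continuous_fderiv one_ne_zero).comp continuous_fst).clm_apply (hvel.comp continuous_snd)
  have h1 : Integrable (fun z : R3 × R3 => w z.1 * gam z.2 * fderiv ℝ g z (vel z.2, 0)) :=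
    ((by fun_prop : Continuous fun z : R3 × R3 => w z.1 * gam z.2).mul
      (continuous_fderiv_apply_of_contDiff hg (by fun_prop))).integrable_of_hasCompactSupport
      (hasCompactSupport_fderiv_apply hc _).mul_left
  have h2 : Integrable (fun z : R3 × R3 => fderiv ℝ w z.1 (vel z.2) * gam z.2 * g z) :=
    (by fun_prop : Continuous fun z : R3 × R3 =>
      fderiv ℝ w z.1 (vel z.2) * gam z.2 * g z).integrable_of_hasCompactSupport hc.mul_left
  rw [Measure.volume_eq_prod] at h1 h2 ⊢
  rw [integral_prod_symm _ h1, integral_prod_symm _ h2, ← integral_neg]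
  refine integral_congr_ae (Filter.Eventually.of_forall fun p => ?_)
  have h := integral_mul_fderiv_eq_neg (μ := volume) hw
    (hg.comp (contDiff_prodMk_left p)) (hasCompactSupport_slice_fst hc p) (vel p)
  simp only [Function.comp_def, fderiv_slice_fst hg] at h
  have e1 : ∀ x, w x * gam p * fderiv ℝ g (x, p) (vel p, 0) =
      gam p * (w x * fderiv ℝ g (x, p) (vel p, 0)) := fun x => by ring
  have e2 : ∀ x, fderiv ℝ w x (vel p) * gam p * g (x, p) =
      gam p * (fderiv ℝ w x (vel p) * g (x, p)) := fun x => by ring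
  simp only [e1, e2, integral_const_mul, h, mul_neg]

theorem integral_transport_momentum (hg : ContDiff ℝ 1 g) (hc : HasCompactSupport g)
    (hw : Continuous w) {F G : R3 → R3} (hF : Continuous F) (hG : Continuous G) :
    ∫ z : R3 × R3, w z.1 * gam z.2 *
        fderiv ℝ g z (0, F z.1 + cross (vel z.2) (G z.1)) =
      -∫ z : R3 × R3, w z.1 * inner ℝ (vel z.2) (F z.1) * g z := by
  have hgam := contDiff_gam.continuous
  have hvel := contDiff_vel.continuous
  have hgc := hg.continuous
  have hcr : Continuous (fun z : R3 × R3 => cross (vel z.2) (G z.1)) :=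
    (contDiff_cross (n := 0)).continuous.comp
      ((hvel.comp continuous_snd).prodMk (hG.comp continuous_fst))
  have h1 : Integrable (fun z : R3 × R3 => w z.1 * gam z.2 *
      fderiv ℝ g z (0, F z.1 + cross (vel z.2) (G z.1))) :=
    ((by fun_prop : Continuous fun z : R3 × R3 => w z.1 * gam z.2).mul
      (continuous_fderiv_apply_of_contDiff hg (by fun_prop))).integrable_of_hasCompactSupport
      (hasCompactSupport_fderiv_apply hc _).mul_left
  have h2 : Integrable (fun z : R3 × R3 => w z.1 * inner ℝ (vel z.2) (F z.1) * g z) :=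
    (by fun_prop : Continuous fun z : R3 × R3 =>
      w z.1 * inner ℝ (vel z.2) (F z.1) * g z).integrable_of_hasCompactSupport hc.mul_left
  rw [Measure.volume_eq_prod] at h1 h2 ⊢
  rw [integral_prod _ h1, integral_prod _ h2, ← integral_neg]
  refine integral_congr_ae (Filter.Eventually.of_forall fun x => ?_)
  have h := integral_gam_mul_fderiv_force (hg.comp (contDiff_prodMk_right x))
    (hasCompactSupport_slice_snd hc x) (F x) (G x)
  simp only [Function.comp_def, fderiv_slice_snd hg] at h
  simp only [mul_assoc, integral_const_mul, h, mul_neg]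

end Transport

/-! ### The weighted energy -/

/-- The kinetic energy with weight `w`. -/
def kineticEnergy (w : R3 → ℝ) (g : R3 → R3 → ℝ) : ℝ :=
  ∫ z : R3 × R3, w z.1 * gam z.2 * g z.1 z.2

/-- The field energy with weight `w`, up to the factor `1 / (8π)`. -/
def fieldEnergy (w : R3 → ℝ) (E B : R3 → R3) : ℝ := ∫ x, w x * (‖E x‖ ^ 2 + ‖B x‖ ^ 2)

/-- The power that the electric field transfers to the particles, with weight `w`. -/
def power (w : R3 → ℝ) (g : R3 → R3 → ℝ) (E : R3 → R3) : ℝ :=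
  ∫ z : R3 × R3, w z.1 * inner ℝ (vel z.2) (E z.1) * g z.1 z.2

theorem continuous_cur {g : R3 → R3 → ℝ} (hg : Continuous (fun z : R3 × R3 => g z.1 z.2))
    (hc : HasCompactSupport (fun z : R3 × R3 => g z.1 z.2)) : Continuous (cur g) := by
  rw [← continuousOn_univ]
  refine continuousOn_integral_of_compact_support (hc.isCompact.image continuous_snd)
    (hg.smul (contDiff_vel.continuous.comp continuous_snd)).continuousOn fun x p _ hp => ?_
  have : g x p = 0 := by
    by_contra hne
    exact hp ⟨(x, p), subset_tsupport _ hne, rfl⟩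
  simp [this]

theorem continuous_rho {g : R3 → R3 → ℝ} (hg : Continuous (fun z : R3 × R3 => g z.1 z.2))
    (hc : HasCompactSupport (fun z : R3 × R3 => g z.1 z.2)) : Continuous (rho g) := by
  rw [← continuousOn_univ]
  refine continuousOn_integral_of_compact_support (hc.isCompact.image continuous_snd)
    hg.continuousOn fun x p _ hp => ?_
  by_contra hne
  exact hp ⟨(x, p), subset_tsupport _ hne, rfl⟩

theorem continuous_curl {F : R3 → R3} (hF : ContDiff ℝ 1 F) : Continuous (curl F) := by
  have h (i k : Fin 3) : Continuous (pd F i k) :=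
    (EuclideanSpace.proj k : R3 →L[ℝ] ℝ).continuous.comp
      ((hF.continuous_fderiv one_ne_zero).clm_apply continuous_const)
  refine (PiLp.continuous_toLp 2 _).comp (continuous_pi fun i => ?_)
  fin_cases i
  · exact (h 1 2).sub (h 2 1)
  · exact (h 2 0).sub (h 0 2)
  · exact (h 0 1).sub (h 1 0)

/-- Particles produce the power as a phase space integral, Ampère's law as a spatial integral
against the current; the two must be identified before they can cancel. -/
theorem power_eq_integral_cur {w : R3 → ℝ} {g : R3 → R3 → ℝ} {E : R3 → R3} (hw : Continuous w)
    (hg : Continuous (fun z : R3 × R3 => g z.1 z.2))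
    (hc : HasCompactSupport (fun z : R3 × R3 => g z.1 z.2)) (hE : Continuous E) :
    power w g E = ∫ x, w x * inner ℝ (E x) (cur g x) := by
  have hvel := contDiff_vel.continuous
  have h1 : Integrable (fun z : R3 × R3 => w z.1 * inner ℝ (vel z.2) (E z.1) * g z.1 z.2) :=
    ((by fun_prop : Continuous fun z : R3 × R3 => w z.1 * inner ℝ (vel z.2) (E z.1)).mul
      hg).integrable_of_hasCompactSupport hc.mul_left
  rw [power, Measure.volume_eq_prod, integral_prod _ h1]
  refine integral_congr_ae (Filter.Eventually.of_forall fun x => ?_)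
  have hint : Integrable (fun p => g x p • vel p) :=
    ((hg.comp (Continuous.prodMk_right x)).smul hvel).integrable_of_hasCompactSupport
      (hasCompactSupport_slice_snd hc x).smul_right
  simp only [cur]
  rw [← integral_inner hint, ← integral_const_mul]
  refine integral_congr_ae (Filter.Eventually.of_forall fun p => ?_)
  simp only [inner_smul_right, real_inner_comm (vel p)]
  ring

/-! ### Time derivatives of the weighted energies -/

namespace IsClassicalSolution

variable {a b t : ℝ} {f : ℝ → R3 → R3 → ℝ} {E B : ℝ → R3 → R3}

theorem contDiff_density {I : Set ℝ} (h : IsClassicalSolution I f E B) (ht : t ∈ I) :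
    ContDiff ℝ 1 (fun z : R3 × R3 => f t z.1 z.2) := contDiff_of_slab ht h.contDiffOn_f

theorem contDiff_electric {I : Set ℝ} (h : IsClassicalSolution I f E B) (ht : t ∈ I) :
    ContDiff ℝ 1 (E t) := contDiff_of_slab ht h.contDiffOn_E

theorem contDiff_magnetic {I : Set ℝ} (h : IsClassicalSolution I f E B) (ht : t ∈ I) :
    ContDiff ℝ 1 (B t) := contDiff_of_slab ht h.contDiffOn_B

theorem hasDerivAt_density (h : IsClassicalSolution (Icc a b) f E B) (ht : t ∈ Ioo a b)
    (x p : R3) :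
    HasDerivAt (fun s => f s x p)
      (-(fderiv ℝ (fun z : R3 × R3 => f t z.1 z.2) (x, p) (vel p, 0)
        + fderiv ℝ (fun z : R3 × R3 => f t z.1 z.2) (x, p)
          (0, E t x + cross (vel p) (B t x)))) t := by
  have ht' := Ioo_subset_Icc_self ht
  have hd : HasDerivAt (fun s => f s x p) (derivWithin (fun s => f s x p) (Icc a b) t) t :=
    (hasDerivWithinAt_of_slab ((h.contDiffOn_f.differentiableOn one_ne_zero) (t, x, p)
    ⟨ht', mem_univ _⟩).hasFDerivWithinAt).differentiableWithinAt.hasDerivWithinAt.hasDerivAt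
    (Icc_mem_nhds ht.1 ht.2)
  refine hd.congr_deriv ?_
  have hv := h.vlasov t ht' x p
  rw [fderiv_slice_fst (h.contDiff_density ht'), fderiv_slice_snd (h.contDiff_density ht')] at hv
  linarith

theorem hasDerivAt_electric (h : IsClassicalSolution (Icc a b) f E B) (ht : t ∈ Ioo a b) (x : R3) :
    HasDerivAt (fun s => E s x) (curl (B t) x - (4 * Real.pi) • cur (f t) x) t := by
  have ht' := Ioo_subset_Icc_self ht
  have hd : HasDerivAt (fun s => E s x) (derivWithin (fun s => E s x) (Icc a b) t) t :=
    (hasDerivWithinAt_of_slab ((h.contDiffOn_E.differentiableOn one_ne_zero) (t, x)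
    ⟨ht', mem_univ _⟩).hasFDerivWithinAt).differentiableWithinAt.hasDerivWithinAt.hasDerivAt
    (Icc_mem_nhds ht.1 ht.2)
  refine hd.congr_deriv ?_
  rw [sub_eq_add_neg, ← neg_smul, ← h.ampere t ht' x, add_sub_cancel]

theorem hasDerivAt_magnetic (h : IsClassicalSolution (Icc a b) f E B) (ht : t ∈ Ioo a b) (x : R3) :
    HasDerivAt (fun s => B s x) (-curl (E t) x) t := by
  have ht' := Ioo_subset_Icc_self ht
  have hd : HasDerivAt (fun s => B s x) (derivWithin (fun s => B s x) (Icc a b) t) t :=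
    (hasDerivWithinAt_of_slab ((h.contDiffOn_B.differentiableOn one_ne_zero) (t, x)
    ⟨ht', mem_univ _⟩).hasFDerivWithinAt).differentiableWithinAt.hasDerivWithinAt.hasDerivAt
    (Icc_mem_nhds ht.1 ht.2)
  refine hd.congr_deriv ?_
  exact eq_neg_of_add_eq_zero_left (h.faraday t ht' x)

variable {S σ : ℝ} {K : Set (R3 × R3)}

theorem contDiffOn_kinetic (h : IsClassicalSolution (Icc a b) f E B) (S σ : ℝ) :
    ContDiffOn ℝ 1 (fun z : ℝ × R3 × R3 => weight S σ z.1 z.2.1 * gam z.2.2 * f z.1 z.2.1 z.2.2)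
      (Icc a b ×ˢ univ) := by
  have hx : ContDiff ℝ 1 (fun z : ℝ × R3 × R3 => z.2.1) := by fun_prop
  have hp : ContDiff ℝ 1 (fun z : ℝ × R3 × R3 => z.2.2) := by fun_prop
  have hgam : ContDiff ℝ 1 (fun z : ℝ × R3 × R3 => gam z.2.2) := contDiff_gam.comp hp
  have hcone : ContDiff ℝ 1 (fun z : ℝ × R3 × R3 => gam z.2.1 + σ * z.1) :=
    (contDiff_gam.comp hx).add (by fun_prop)
  have hw : ContDiff ℝ 1 (fun z : ℝ × R3 × R3 => weight S σ z.1 z.2.1) :=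
    (contDiff_cutoff S).comp hcone
  exact (hw.mul hgam).contDiffOn.mul h.contDiffOn_f

theorem contDiffOn_field (h : IsClassicalSolution (Icc a b) f E B) (S σ : ℝ) :
    ContDiffOn ℝ 1 (fun z : ℝ × R3 => weight S σ z.1 z.2 * (‖E z.1 z.2‖ ^ 2 + ‖B z.1 z.2‖ ^ 2))
      (Icc a b ×ˢ univ) :=
  (contDiff_weight S σ).contDiffOn.mul
    ((h.contDiffOn_E.norm_sq ℝ).add (h.contDiffOn_B.norm_sq ℝ))

/-- The Vlasov equation replaces `∂ₜ f`. Transport in position moves onto the weight and joins its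
time derivative in the slope term; the force leaves only the electric power. -/
theorem hasDerivAt_kineticEnergy (h : IsClassicalSolution (Icc a b) f E B) (hK : IsCompact K)
    (hf : ∀ s ∈ Icc a b, ∀ z ∉ K, f s z.1 z.2 = 0) (ht : t ∈ Ioo a b) :
    HasDerivAt (fun s => kineticEnergy (weight S σ s) (f s))
      ((∫ z : R3 × R3, weightSlope S σ t z.1 * (σ + inner ℝ (vel z.1) (vel z.2)) * gam z.2
        * f t z.1 z.2) + power (weight S σ t) (f t) (E t)) t := by
  have ht' := Ioo_subset_Icc_self ht
  have hg := h.contDiff_density ht'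
  have hgc := hg.continuous
  have hc : HasCompactSupport (fun z : R3 × R3 => f t z.1 z.2) :=
    HasCompactSupport.intro hK (hf t ht')
  have hw := contDiff_weight_slice S σ t
  have hwc := hw.continuous
  have hws := continuous_weightSlope S σ t
  have hgam := contDiff_gam.continuous
  have hvel := contDiff_vel.continuous
  have hE := (h.contDiff_electric ht').continuous
  have hB := (h.contDiff_magnetic ht').continuous
  have hcr : Continuous (fun z : R3 × R3 => cross (vel z.2) (B t z.1)) :=
    (contDiff_cross (n := 0)).continuous.comp
      ((hvel.comp continuous_snd).prodMk (hB.comp continuous_fst))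
  have hd := hasDerivAt_integral_of_slab (μ := volume) (h.contDiffOn_kinetic S σ) hK
    (fun s hs z hz => by simp [hf s hs z hz]) ht fun z =>
    (((hasDerivAt_weight S σ t z.1).mul_const (gam z.2)).mul (h.hasDerivAt_density ht z.1 z.2))
  refine hd.congr_deriv ?_
  have i1 : Integrable (fun z : R3 × R3 =>
      σ * (weightSlope S σ t z.1 * gam z.2 * f t z.1 z.2)) :=
    (((by fun_prop : Continuous fun z : R3 × R3 => weightSlope S σ t z.1 * gam z.2).mul
      hgc).integrable_of_hasCompactSupport hc.mul_left).const_mul σ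
  have i2 : Integrable (fun z : R3 × R3 => weight S σ t z.1 * gam z.2 *
      fderiv ℝ (fun z : R3 × R3 => f t z.1 z.2) z (vel z.2, 0)) :=
    ((by fun_prop : Continuous fun z : R3 × R3 => weight S σ t z.1 * gam z.2).mul
      (continuous_fderiv_apply_of_contDiff hg (by fun_prop))).integrable_of_hasCompactSupport
      (hasCompactSupport_fderiv_apply hc _).mul_left
  have i3 : Integrable (fun z : R3 × R3 => weight S σ t z.1 * gam z.2 *
      fderiv ℝ (fun z : R3 × R3 => f t z.1 z.2) z (0, E t z.1 + cross (vel z.2) (B t z.1))) :=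
    ((by fun_prop : Continuous fun z : R3 × R3 => weight S σ t z.1 * gam z.2).mul
      (continuous_fderiv_apply_of_contDiff hg (by fun_prop))).integrable_of_hasCompactSupport
      (hasCompactSupport_fderiv_apply hc _).mul_left
  have i4 : Integrable (fun z : R3 × R3 =>
      weightSlope S σ t z.1 * inner ℝ (vel z.1) (vel z.2) * gam z.2 * f t z.1 z.2) :=
    ((by fun_prop : Continuous fun z : R3 × R3 =>
      weightSlope S σ t z.1 * inner ℝ (vel z.1) (vel z.2) * gam z.2).mul
      hgc).integrable_of_hasCompactSupport hc.mul_left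
  have i12 : Integrable (fun z : R3 × R3 =>
      σ * (weightSlope S σ t z.1 * gam z.2 * f t z.1 z.2) - weight S σ t z.1 * gam z.2 *
      fderiv ℝ (fun z : R3 × R3 => f t z.1 z.2) z (vel z.2, 0)) := i1.sub i2
  have e1 : ∀ z : R3 × R3, σ * weightSlope S σ t z.1 * gam z.2 * f t z.1 z.2 +
      weight S σ t z.1 * gam z.2 *
        -(fderiv ℝ (fun z : R3 × R3 => f t z.1 z.2) (z.1, z.2) (vel z.2, 0)
        + fderiv ℝ (fun z : R3 × R3 => f t z.1 z.2) (z.1, z.2)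
          (0, E t z.1 + cross (vel z.2) (B t z.1))) =
      σ * (weightSlope S σ t z.1 * gam z.2 * f t z.1 z.2) - weight S σ t z.1 * gam z.2 *
        fderiv ℝ (fun z : R3 × R3 => f t z.1 z.2) z (vel z.2, 0) - weight S σ t z.1 * gam z.2 *
        fderiv ℝ (fun z : R3 × R3 => f t z.1 z.2) z
          (0, E t z.1 + cross (vel z.2) (B t z.1)) := fun z => by
    rw [Prod.mk.eta]; ring
  have e2 : ∀ z : R3 × R3,
      weightSlope S σ t z.1 * (σ + inner ℝ (vel z.1) (vel z.2)) * gam z.2 * f t z.1 z.2 =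
      σ * (weightSlope S σ t z.1 * gam z.2 * f t z.1 z.2) +
      weightSlope S σ t z.1 * inner ℝ (vel z.1) (vel z.2) * gam z.2 * f t z.1 z.2 := fun z => by
    ring
  rw [integral_congr_ae (Filter.Eventually.of_forall e1),
    integral_congr_ae (Filter.Eventually.of_forall e2), integral_sub i12 i3,
    integral_sub i1 i2, integral_add i1 i4, integral_transport_position hg hc hw,
    integral_transport_momentum hg hc hwc hE hB, power]
  simp only [fderiv_weight]
  ring

/-- The curl terms combine into the Poynting flux through the cone. The source `-4πj`, doubled by
differentiating the square, gives `-8π` times the power. -/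
theorem hasDerivAt_fieldEnergy (h : IsClassicalSolution (Icc a b) f E B) (hK : IsCompact K)
    (hf : ∀ s ∈ Icc a b, ∀ z ∉ K, f s z.1 z.2 = 0) (hσ : |σ| = 1) (h0 : (0 : ℝ) ∈ Icc a b)
    (ht : t ∈ Ioo a b) :
    HasDerivAt (fun s => fieldEnergy (weight S σ s) (E s) (B s))
      ((∫ x, weightSlope S σ t x * (σ * (‖E t x‖ ^ 2 + ‖B t x‖ ^ 2)
        + 2 * inner ℝ (vel x) (cross (E t x) (B t x))))
        - 8 * Real.pi * power (weight S σ t) (f t) (E t)) t := by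
  have ht' := Ioo_subset_Icc_self ht
  have hc : HasCompactSupport (fun z : R3 × R3 => f t z.1 z.2) :=
    HasCompactSupport.intro hK (hf t ht')
  have hw := contDiff_weight_slice S σ t
  have hE := h.contDiff_electric ht'
  have hB := h.contDiff_magnetic ht'
  have hgc := (h.contDiff_density ht').continuous
  have hball := isCompact_closedBall (0 : R3) (S + 1 + (b - a))
  have hwsupp : HasCompactSupport (weight S σ t) :=
    HasCompactSupport.intro hball fun x hx => weight_eq_zero (le_of_notMem_closedBall hσ h0 ht' hx)
  have hd := hasDerivAt_integral_of_slab (μ := volume) (h.contDiffOn_field S σ) hball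
    (fun s hs x hx => by simp [weight_eq_zero (le_of_notMem_closedBall hσ h0 hs hx)]) ht fun x =>
    (hasDerivAt_weight S σ t x).mul
      ((h.hasDerivAt_electric ht x).norm_sq.add (h.hasDerivAt_magnetic ht x).norm_sq)
  refine hd.congr_deriv ?_
  have hslope : HasCompactSupport (weightSlope S σ t) :=
    HasCompactSupport.intro hball fun x hx =>
      weightSlope_eq_zero (le_of_notMem_closedBall hσ h0 ht' hx)
  have hEc := hE.continuous
  have hBc := hB.continuous
  have hwc := hw.continuous
  have hws := continuous_weightSlope S σ t
  have hvel := contDiff_vel.continuous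
  have hcur := continuous_cur hgc hc
  have hcurlE := continuous_curl hE
  have hcurlB := continuous_curl hB
  have hcr : Continuous (fun x => cross (E t x) (B t x)) :=
    (contDiff_cross (n := 0)).continuous.comp (hEc.prodMk hBc)
  have i1 : Integrable (fun x => weightSlope S σ t x * (σ * (‖E t x‖ ^ 2 + ‖B t x‖ ^ 2))) :=
    (by fun_prop : Continuous _).integrable_of_hasCompactSupport hslope.mul_right
  have i2 : Integrable (fun x => 2 * (weight S σ t x *
      (inner ℝ (E t x) (curl (B t) x) - inner ℝ (B t x) (curl (E t) x)))) :=
    ((by fun_prop : Continuous _).integrable_of_hasCompactSupport hwsupp.mul_right).const_mul 2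
  have i3 : Integrable (fun x => 8 * Real.pi * (weight S σ t x *
      inner ℝ (E t x) (cur (f t) x))) :=
    ((by fun_prop : Continuous _).integrable_of_hasCompactSupport hwsupp.mul_right).const_mul _
  have i4 : Integrable (fun x => 2 * (weightSlope S σ t x *
      inner ℝ (vel x) (cross (E t x) (B t x)))) :=
    ((by fun_prop : Continuous _).integrable_of_hasCompactSupport hslope.mul_right).const_mul 2
  have i12 : Integrable (fun x => weightSlope S σ t x * (σ * (‖E t x‖ ^ 2 + ‖B t x‖ ^ 2)) +
      2 * (weight S σ t x *
      (inner ℝ (E t x) (curl (B t) x) - inner ℝ (B t x) (curl (E t) x)))) := i1.add i2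
  have e1 : ∀ x, σ * weightSlope S σ t x * (‖E t x‖ ^ 2 + ‖B t x‖ ^ 2) + weight S σ t x *
      (2 * inner ℝ (E t x) (curl (B t) x - (4 * Real.pi) • cur (f t) x) +
        2 * inner ℝ (B t x) (-curl (E t) x)) =
      weightSlope S σ t x * (σ * (‖E t x‖ ^ 2 + ‖B t x‖ ^ 2)) + 2 * (weight S σ t x *
      (inner ℝ (E t x) (curl (B t) x) - inner ℝ (B t x) (curl (E t) x))) -
      8 * Real.pi * (weight S σ t x * inner ℝ (E t x) (cur (f t) x)) := fun x => by
    rw [inner_sub_right, inner_neg_right, inner_smul_right]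
    ring
  have e2 : ∀ x, weightSlope S σ t x * (σ * (‖E t x‖ ^ 2 + ‖B t x‖ ^ 2)
      + 2 * inner ℝ (vel x) (cross (E t x) (B t x))) =
      weightSlope S σ t x * (σ * (‖E t x‖ ^ 2 + ‖B t x‖ ^ 2)) +
      2 * (weightSlope S σ t x * inner ℝ (vel x) (cross (E t x) (B t x))) := fun x => by
    ring
  rw [integral_congr_ae (Filter.Eventually.of_forall e1),
    integral_congr_ae (Filter.Eventually.of_forall e2), integral_sub i12 i3,
    integral_add i1 i2, integral_add i1 i4, integral_const_mul, integral_const_mul,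
    integral_const_mul, integral_mul_inner_curl hE hB hw hwsupp,
    power_eq_integral_cur hwc hgc hc hEc]
  simp only [fderiv_weight]

end IsClassicalSolution

/-! ### Monotonicity along light cones and the energy bound -/

namespace IsClassicalSolution

variable {a b t : ℝ} {f : ℝ → R3 → R3 → ℝ} {E B : ℝ → R3 → R3} {S σ : ℝ} {K : Set (R3 × R3)}

theorem continuousOn_kineticEnergy (h : IsClassicalSolution (Icc a b) f E B) (hK : IsCompact K)
    (hf : ∀ s ∈ Icc a b, ∀ z ∉ K, f s z.1 z.2 = 0) :
    ContinuousOn (fun s => kineticEnergy (weight S σ s) (f s)) (Icc a b) :=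
  continuousOn_integral_of_compact_support hK (h.contDiffOn_kinetic S σ).continuousOn
    fun s z hs hz => by simp [hf s hs z hz]

theorem continuousOn_fieldEnergy (h : IsClassicalSolution (Icc a b) f E B) (hσ : |σ| = 1)
    (h0 : (0 : ℝ) ∈ Icc a b) :
    ContinuousOn (fun s => fieldEnergy (weight S σ s) (E s) (B s)) (Icc a b) :=
  continuousOn_integral_of_compact_support (isCompact_closedBall (0 : R3) (S + 1 + (b - a)))
    (h.contDiffOn_field S σ).continuousOn
    fun s x hs hx => by simp [weight_eq_zero (le_of_notMem_closedBall hσ h0 hs hx)]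

theorem one_add_mul_inner_nonneg (hσ : |σ| = 1) {u v : R3} (hu : ‖u‖ ≤ 1) (hv : ‖v‖ ≤ 1) :
    0 ≤ 1 + σ * inner ℝ u v := by
  have h1 : |σ * inner ℝ u v| ≤ 1 := by
    rw [abs_mul, hσ, one_mul]
    refine (abs_real_inner_le_norm u v).trans ?_
    nlinarith [norm_nonneg u, norm_nonneg v]
  linarith [neg_abs_le (σ * inner ℝ u v)]

/-- The Poynting flux never exceeds the field energy density, by `2 ‖v‖ ‖w‖ ≤ ‖v‖² + ‖w‖²`: field
energy travels at most at the speed of light. -/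
theorem norm_sq_add_norm_sq_add_inner_cross_nonneg (hσ : |σ| = 1) {u : R3} (hu : ‖u‖ ≤ 1)
    (v w : R3) : 0 ≤ ‖v‖ ^ 2 + ‖w‖ ^ 2 + 2 * (σ * inner ℝ u (cross v w)) := by
  have h1 : |σ * inner ℝ u (cross v w)| ≤ ‖v‖ * ‖w‖ := by
    rw [abs_mul, hσ, one_mul]
    refine (abs_real_inner_le_norm u _).trans ((mul_le_of_le_one_left (norm_nonneg _) hu).trans ?_)
    exact norm_cross_le v w
  nlinarith [neg_abs_le (σ * inner ℝ u (cross v w)), sq_nonneg (‖v‖ - ‖w‖)]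

/-- The total energy inside smoothed light cones is monotone. -/
theorem antitoneOn_energy (h : IsClassicalSolution (Icc a b) f E B) (hK : IsCompact K)
    (hf : ∀ s ∈ Icc a b, ∀ z ∉ K, f s z.1 z.2 = 0) (hpos : ∀ s ∈ Icc a b, ∀ x p, 0 ≤ f s x p)
    (hσ : |σ| = 1) (h0 : (0 : ℝ) ∈ Icc a b) :
    AntitoneOn (fun s => σ * (kineticEnergy (weight S σ s) (f s) +
      1 / (8 * Real.pi) * fieldEnergy (weight S σ s) (E s) (B s))) (Icc a b) := by
  have hσ2 : σ * σ = 1 := by rw [← abs_mul_abs_self, hσ, one_mul]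
  have hd : ∀ t ∈ Ioo a b, HasDerivAt (fun s => σ * (kineticEnergy (weight S σ s) (f s) +
      1 / (8 * Real.pi) * fieldEnergy (weight S σ s) (E s) (B s)))
      (σ * ((∫ z : R3 × R3, weightSlope S σ t z.1 * (σ + inner ℝ (vel z.1) (vel z.2)) * gam z.2
        * f t z.1 z.2) + 1 / (8 * Real.pi) *
        ∫ x, weightSlope S σ t x * (σ * (‖E t x‖ ^ 2 + ‖B t x‖ ^ 2)
        + 2 * inner ℝ (vel x) (cross (E t x) (B t x))))) t := fun t ht => by
    refine (((h.hasDerivAt_kineticEnergy hK hf ht).add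
      ((h.hasDerivAt_fieldEnergy hK hf hσ h0 ht).const_mul (1 / (8 * Real.pi)))).const_mul
      σ).congr_deriv ?_
    -- The factor `1 / (8π)` makes the two `power` terms cancel.
    have := Real.pi_ne_zero
    field_simp
    ring
  refine antitoneOn_of_deriv_nonpos (convex_Icc a b) ?_ ?_ ?_
  · exact continuousOn_const.mul ((h.continuousOn_kineticEnergy hK hf).add
      (continuousOn_const.mul (h.continuousOn_fieldEnergy hσ h0)))
  · rw [interior_Icc]
    exact fun t ht => (hd t ht).differentiableAt.differentiableWithinAt
  · rw [interior_Icc]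
    intro t ht
    rw [(hd t ht).deriv, mul_add, mul_left_comm, ← integral_const_mul, ← integral_const_mul]
    have h1 : ∫ z : R3 × R3, σ * (weightSlope S σ t z.1 * (σ + inner ℝ (vel z.1) (vel z.2)) *
        gam z.2 * f t z.1 z.2) ≤ 0 := integral_nonpos fun z => by
      have e : σ * (weightSlope S σ t z.1 * (σ + inner ℝ (vel z.1) (vel z.2)) *
          gam z.2 * f t z.1 z.2) = weightSlope S σ t z.1 *
          ((1 + σ * inner ℝ (vel z.1) (vel z.2)) * gam z.2 * f t z.1 z.2) := by
        rw [← hσ2]; ring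
      rw [e]
      exact mul_nonpos_of_nonpos_of_nonneg weightSlope_nonpos (mul_nonneg (mul_nonneg
        (one_add_mul_inner_nonneg hσ (norm_vel_le _) (norm_vel_le _)) (gam_pos _).le)
        (hpos t (Ioo_subset_Icc_self ht) _ _))
    have h2 : ∫ x, σ * (weightSlope S σ t x * (σ * (‖E t x‖ ^ 2 + ‖B t x‖ ^ 2)
        + 2 * inner ℝ (vel x) (cross (E t x) (B t x)))) ≤ 0 := integral_nonpos fun x => by
      have e : σ * (weightSlope S σ t x * (σ * (‖E t x‖ ^ 2 + ‖B t x‖ ^ 2)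
          + 2 * inner ℝ (vel x) (cross (E t x) (B t x)))) = weightSlope S σ t x *
          (‖E t x‖ ^ 2 + ‖B t x‖ ^ 2 + 2 * (σ * inner ℝ (vel x) (cross (E t x) (B t x)))) := by
        linear_combination weightSlope S σ t x * (‖E t x‖ ^ 2 + ‖B t x‖ ^ 2) * hσ2
      rw [e]
      exact mul_nonpos_of_nonpos_of_nonneg weightSlope_nonpos
        (norm_sq_add_norm_sq_add_inner_cross_nonneg hσ (norm_vel_le _) _ _)
    have h3 := mul_nonpos_of_nonneg_of_nonpos
      (by positivity : (0 : ℝ) ≤ 1 / (8 * Real.pi)) h2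
    exact add_nonpos h1 h3

/-- The cone has to narrow on the way from time `0` to time `t`, so `σ` is chosen according to the
sign of `t`. -/
theorem energy_le (h : IsClassicalSolution (Icc a b) f E B) (hK : IsCompact K)
    (hf : ∀ s ∈ Icc a b, ∀ z ∉ K, f s z.1 z.2 = 0) (hpos : ∀ s ∈ Icc a b, ∀ x p, 0 ≤ f s x p)
    (h0 : (0 : ℝ) ∈ Icc a b) (ht : t ∈ Icc a b) (S : ℝ) :
    ∃ σ : ℝ, |σ| = 1 ∧ kineticEnergy (weight S σ t) (f t) +
      1 / (8 * Real.pi) * fieldEnergy (weight S σ t) (E t) (B t) ≤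
      kineticEnergy (weight S σ 0) (f 0) +
      1 / (8 * Real.pi) * fieldEnergy (weight S σ 0) (E 0) (B 0) := by
  rcases le_total 0 t with h1 | h1
  · have := h.antitoneOn_energy (S := S) (σ := 1) hK hf hpos (by simp) h0 h0 ht h1
    exact ⟨1, by simp, by simpa using this⟩
  · have := h.antitoneOn_energy (S := S) (σ := -1) hK hf hpos (by simp) h0 ht h0 h1
    exact ⟨-1, by simp, by simpa only [neg_mul, one_mul, neg_le_neg_iff] using this⟩

/-- The kinetic energy is bounded by the initial energy. -/
theorem integral_gam_mul_le (h : IsClassicalSolution (Icc a b) f E B) (hK : IsCompact K)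
    (hf : ∀ s ∈ Icc a b, ∀ z ∉ K, f s z.1 z.2 = 0) (hpos : ∀ s ∈ Icc a b, ∀ x p, 0 ≤ f s x p)
    (h0 : (0 : ℝ) ∈ Icc a b) (ht : t ∈ Icc a b) (hE : MemLp (E 0) 2) (hB : MemLp (B 0) 2) :
    ∫ x, ∫ p, gam p * f t x p ≤ energy (f 0) (E 0) (B 0) := by
  have hint : ∀ s ∈ Icc a b, ∀ w : R3 → ℝ, Continuous w →
      Integrable (fun z : R3 × R3 => w z.1 * gam z.2 * f s z.1 z.2) := fun s hs w hw => by
    have hgam := contDiff_gam.continuous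
    exact ((by fun_prop : Continuous fun z : R3 × R3 => w z.1 * gam z.2).mul
      (h.contDiff_density hs).continuous).integrable_of_hasCompactSupport
      (HasCompactSupport.intro hK (hf s hs)).mul_left
  have hprod : ∀ s ∈ Icc a b, ∫ x, ∫ p, gam p * f s x p =
      ∫ z : R3 × R3, gam z.2 * f s z.1 z.2 := fun s hs => by
    have := hint s hs (fun _ => 1) continuous_const
    simp only [one_mul] at this
    rw [Measure.volume_eq_prod] at this ⊢
    rw [integral_prod _ this]
  obtain ⟨R, hR⟩ := hK.isBounded.exists_norm_le
  -- With `S = 1 + R + |t|` the weight at time `t` is `1` on the support of `f t`, because `gam x ≤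
  -- 1 + ‖x‖` and `σ * t ≤ |t|`. The field energy at time `t` is merely dropped as nonnegative.
  obtain ⟨σ, hσ, hle⟩ := h.energy_le hK hf hpos h0 ht (1 + R + |t|)
  have hkin : kineticEnergy (weight (1 + R + |t|) σ t) (f t) =
      ∫ z : R3 × R3, gam z.2 * f t z.1 z.2 := by
    refine integral_congr_ae (Filter.Eventually.of_forall fun z => ?_)
    simp only
    by_cases hz : z ∈ K
    · rw [weight_eq_one, one_mul]
      have h1 : ‖z.1‖ ≤ R := (norm_fst_le z).trans (hR z hz)
      have h2 : gam z.1 ≤ 1 + ‖z.1‖ :=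
        Real.sqrt_le_iff.2 ⟨by positivity, by nlinarith [norm_nonneg z.1]⟩
      have h3 : σ * t ≤ |t| := by
        have := le_abs_self (σ * t)
        rwa [abs_mul, hσ, one_mul] at this
      linarith
    · simp [hf t ht z hz]
  have hfield : 0 ≤ 1 / (8 * Real.pi) * fieldEnergy (weight (1 + R + |t|) σ t) (E t) (B t) :=
    mul_nonneg (by positivity) (integral_nonneg fun x => mul_nonneg weight_nonneg (by positivity))
  have hkin0 : kineticEnergy (weight (1 + R + |t|) σ 0) (f 0) ≤
      ∫ z : R3 × R3, gam z.2 * f 0 z.1 z.2 := by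
    refine integral_mono (hint 0 h0 _ (contDiff_weight_slice _ _ _).continuous)
      (by simpa using hint 0 h0 (fun _ => 1) continuous_const) fun z => ?_
    simp only [mul_assoc]
    exact mul_le_of_le_one_left (mul_nonneg (gam_pos _).le (hpos 0 h0 _ _)) weight_le_one
  have hfield0 : fieldEnergy (weight (1 + R + |t|) σ 0) (E 0) (B 0) ≤
      ∫ x, (‖E 0 x‖ ^ 2 + ‖B 0 x‖ ^ 2) := by
    refine integral_mono_of_nonneg (Filter.Eventually.of_forall fun x =>
      mul_nonneg weight_nonneg (by positivity))
      (hE.integrable_norm_pow two_ne_zero |>.add (hB.integrable_norm_pow two_ne_zero))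
      (Filter.Eventually.of_forall fun x => mul_le_of_le_one_left (by positivity) weight_le_one)
  have := mul_le_mul_of_nonneg_left hfield0 (by positivity : (0 : ℝ) ≤ 1 / (8 * Real.pi))
  rw [energy, hprod t ht, hprod 0 h0]
  linarith

end IsClassicalSolution

/-! ### Interpolation -/

/-- Small momenta are bounded by `M` times the volume of a ball, large ones by the weight, since `1
≤ gam p / r` outside the ball of radius `r`. -/
theorem integral_le_mul_rpow {g : R3 → ℝ} {M : ℝ} (hg : Integrable g)
    (hγ : Integrable fun p => gam p * g p) (hpos : ∀ p, 0 ≤ g p) (hM : ∀ p, g p ≤ M) :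
    ∫ p, g p ≤ (M * volume.real (ball (0 : R3) 1) + 1) * (∫ p, gam p * g p) ^ (3 / 4 : ℝ) := by
  set k := ∫ p, gam p * g p with hk
  have hk0 : 0 ≤ k := integral_nonneg fun p => mul_nonneg (gam_pos p).le (hpos p)
  -- For `k = 0` the optimal radius degenerates, but then `∫ g ≤ k = 0`.
  rcases hk0.eq_or_lt with h0 | h0
  · have : ∫ p, g p ≤ k := integral_mono hg hγ fun p =>
      le_mul_of_one_le_left (hpos p) (one_le_gam p)
    rw [← h0] at this ⊢
    simpa using this
  -- This radius balances the two contributions: `k / r = r³ = k^(3/4)`.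
  set r := k ^ (1 / 4 : ℝ) with hr
  have hr0 : 0 < r := Real.rpow_pos_of_pos h0 _
  have hr3 : r ^ 3 = k ^ (3 / 4 : ℝ) := by
    rw [hr, ← Real.rpow_natCast, ← Real.rpow_mul hk0]; norm_num
  have hr4 : r ^ 4 = k := by
    rw [hr, ← Real.rpow_natCast, ← Real.rpow_mul hk0]; norm_num
  have hM0 : 0 ≤ M := (hpos 0).trans (hM 0)
  have hball : Integrable ((ball (0 : R3) r).indicator fun _ => M) :=
    (integrable_indicator_iff measurableSet_ball).2 (integrableOn_const measure_ball_lt_top.ne)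
  have hvol : volume.real (ball (0 : R3) r) = r ^ 3 * volume.real (ball (0 : R3) 1) := by
    rw [Measure.real, Measure.addHaar_ball _ _ hr0.le, ENNReal.toReal_mul,
      ENNReal.toReal_ofReal (by positivity), finrank_euclideanSpace_fin, Measure.real]
  have hle : ∫ p, g p ≤
      ∫ p, ((ball (0 : R3) r).indicator (fun _ => M) p + r⁻¹ * (gam p * g p)) := by
    refine integral_mono hg (hball.add (hγ.const_mul _)) fun p => ?_
    by_cases hp : p ∈ ball (0 : R3) r
    · simp only [indicator_of_mem hp]
      have : 0 ≤ r⁻¹ * (gam p * g p) :=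
        mul_nonneg (inv_nonneg.2 hr0.le) (mul_nonneg (gam_pos p).le (hpos p))
      linarith [hM p]
    · simp only [indicator_of_notMem hp, zero_add]
      rw [mem_ball_zero_iff, not_lt] at hp
      rw [← mul_assoc]
      refine le_mul_of_one_le_left (hpos p) ?_
      rw [inv_mul_eq_div, one_le_div hr0]
      exact hp.trans (norm_lt_gam p).le
  refine hle.trans (le_of_eq ?_)
  rw [integral_add hball (hγ.const_mul _), integral_indicator_const _ measurableSet_ball, hvol,
    integral_const_mul, ← hk, ← hr3, smul_eq_mul]
  have hrk : r⁻¹ * k = r ^ 3 := by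
    rw [inv_mul_eq_iff_eq_mul₀ hr0.ne', ← hr4]
    ring
  rw [hrk]
  ring

theorem eLpNorm_le_of_norm_le_rpow {X F : Type*} [MeasurableSpace X] {μ : Measure X}
    [NormedAddCommGroup F] {u : X → F} {k : X → ℝ} {D e : ℝ} (hD : 0 ≤ D) (hk : ∀ x, 0 ≤ k x)
    (hint : Integrable k μ) (he : ∫ x, k x ∂μ ≤ e) (hu : ∀ x, ‖u x‖ ≤ D * k x ^ (3 / 4 : ℝ)) :
    eLpNorm u (4 / 3) μ ≤ ENNReal.ofReal ((D ^ (4 / 3 : ℝ) * e) ^ (3 / 4 : ℝ)) := by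
  have hp : (4 / 3 : ENNReal).toReal = 4 / 3 := by simp
  have he0 : 0 ≤ e := (integral_nonneg hk).trans he
  rw [eLpNorm_eq_lintegral_rpow_enorm_toReal (by simp) (ENNReal.div_ne_top (by simp) (by simp)), hp]
  have h1 : ∫⁻ x, ‖u x‖ₑ ^ (4 / 3 : ℝ) ∂μ ≤ ENNReal.ofReal (D ^ (4 / 3 : ℝ) * e) := by
    calc ∫⁻ x, ‖u x‖ₑ ^ (4 / 3 : ℝ) ∂μ
        ≤ ∫⁻ x, ENNReal.ofReal (D ^ (4 / 3 : ℝ) * k x) ∂μ := by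
          refine lintegral_mono fun x => ?_
          rw [← ofReal_norm, ENNReal.ofReal_rpow_of_nonneg (norm_nonneg _) (by norm_num)]
          refine ENNReal.ofReal_le_ofReal ?_
          calc ‖u x‖ ^ (4 / 3 : ℝ) ≤ (D * k x ^ (3 / 4 : ℝ)) ^ (4 / 3 : ℝ) := by
                gcongr
                exact hu x
            _ = D ^ (4 / 3 : ℝ) * k x := by
                rw [Real.mul_rpow hD (Real.rpow_nonneg (hk x) _), ← Real.rpow_mul (hk x)]
                norm_num
      _ = ENNReal.ofReal (∫ x, D ^ (4 / 3 : ℝ) * k x ∂μ) :=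
          (ofReal_integral_eq_lintegral_ofReal (hint.const_mul _) (Filter.Eventually.of_forall
            fun x => mul_nonneg (Real.rpow_nonneg hD _) (hk x))).symm
      _ ≤ ENNReal.ofReal (D ^ (4 / 3 : ℝ) * e) := by
          rw [integral_const_mul]
          gcongr
  rw [← ENNReal.ofReal_rpow_of_nonneg (mul_nonneg (Real.rpow_nonneg hD _) he0) (by norm_num)]
  convert ENNReal.rpow_le_rpow h1 (by norm_num : (0 : ℝ) ≤ 3 / 4) using 2
  norm_num

/-- The bound holds almost everywhere; by continuity the exceptional set is open, and a nonempty
open set has positive measure. -/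
theorem le_of_eLpNorm_top_le {g : R3 × R3 → ℝ} {M : ℝ} (hg : Continuous g) (hM : 0 ≤ M)
    (h : eLpNorm g ⊤ volume ≤ ENNReal.ofReal M) (z : R3 × R3) : g z ≤ M := by
  have hae : ∀ᵐ z, g z ≤ M := by
    rw [eLpNorm_exponent_top] at h
    filter_upwards [ae_le_eLpNormEssSup (f := g) (μ := volume)] with z hz
    have := hz.trans h
    rw [← ofReal_norm, ENNReal.ofReal_le_ofReal_iff hM] at this
    exact (Real.le_norm_self _).trans this
  by_contra! hz
  have hopen : IsOpen {z | M < g z} := isOpen_lt continuous_const hg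
  refine (hopen.measure_pos volume ⟨z, hz⟩).ne' ?_
  rw [ae_iff] at hae
  simpa using hae

/-- The moment estimates for a single phase space density. -/
theorem memLp_rho_cur {g : R3 → R3 → ℝ} {M e : ℝ} (hg : Continuous (fun z : R3 × R3 => g z.1 z.2))
    (hc : HasCompactSupport (fun z : R3 × R3 => g z.1 z.2)) (hpos : ∀ x p, 0 ≤ g x p)
    (hM : ∀ x p, g x p ≤ M) (he : ∫ x, ∫ p, gam p * g x p ≤ e) {C : ℝ}
    (hC : C = ((M * volume.real (ball (0 : R3) 1) + 1) ^ (4 / 3 : ℝ) * e) ^ (3 / 4 : ℝ)) :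
    (MemLp (rho g) (4 / 3) volume ∧ eLpNorm (rho g) (4 / 3) volume ≤ ENNReal.ofReal C) ∧
    (MemLp (cur g) (4 / 3) volume ∧ eLpNorm (cur g) (4 / 3) volume ≤ ENNReal.ofReal C) := by
  have hgam := contDiff_gam.continuous
  have hM0 : 0 ≤ M := (hpos 0 0).trans (hM 0 0)
  have hsl (x : R3) : Continuous (g x) := hg.comp (Continuous.prodMk_right x)
  have hsc (x : R3) : HasCompactSupport (g x) := hasCompactSupport_slice_snd hc x
  have hi (x : R3) : Integrable (g x) := (hsl x).integrable_of_hasCompactSupport (hsc x)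
  have hiγ (x : R3) : Integrable (fun p => gam p * g x p) :=
    (hgam.mul (hsl x)).integrable_of_hasCompactSupport (hsc x).mul_left
  have hprod : Integrable (fun z : R3 × R3 => gam z.2 * g z.1 z.2) (volume.prod volume) := by
    rw [← Measure.volume_eq_prod]
    exact ((hgam.comp continuous_snd).mul hg).integrable_of_hasCompactSupport hc.mul_left
  have hnorm (x : R3) : ‖rho g x‖ = rho g x := Real.norm_of_nonneg (integral_nonneg (hpos x))
  have hrho (x : R3) : ‖rho g x‖ ≤ (M * volume.real (ball (0 : R3) 1) + 1) *
      (∫ p, gam p * g x p) ^ (3 / 4 : ℝ) := by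
    rw [hnorm]
    exact integral_le_mul_rpow (hi x) (hiγ x) (hpos x) (hM x)
  have hcur (x : R3) : ‖cur g x‖ ≤ ‖rho g x‖ := by
    rw [hnorm]
    refine norm_integral_le_of_norm_le (hi x) (Filter.Eventually.of_forall fun p => ?_)
    rw [norm_smul, Real.norm_of_nonneg (hpos x p)]
    exact mul_le_of_le_one_right (hpos x p) (norm_vel_le p)
  have hk (x : R3) : 0 ≤ ∫ p, gam p * g x p :=
    integral_nonneg fun p => mul_nonneg (gam_pos p).le (hpos x p)
  have hD : 0 ≤ M * volume.real (ball (0 : R3) 1) + 1 := by positivity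
  have b1 : eLpNorm (rho g) (4 / 3) volume ≤ ENNReal.ofReal C :=
    hC ▸ eLpNorm_le_of_norm_le_rpow hD hk hprod.integral_prod_left he hrho
  have b2 : eLpNorm (cur g) (4 / 3) volume ≤ ENNReal.ofReal C :=
    hC ▸ eLpNorm_le_of_norm_le_rpow hD hk hprod.integral_prod_left he
      fun x => (hcur x).trans (hrho x)
  exact ⟨⟨⟨(continuous_rho hg hc).aestronglyMeasurable, b1.trans_lt ENNReal.ofReal_lt_top⟩, b1⟩,
    ⟨⟨(continuous_cur hg hc).aestronglyMeasurable, b2.trans_lt ENNReal.ofReal_lt_top⟩, b2⟩⟩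

end RVM

end

/-- A point of a nondegenerate interval containing `0` lies, together with `0`, in a nondegenerate
compact subinterval. -/
theorem RVM.exists_Icc_subset {I : Set ℝ} (hI : I.OrdConnected) (hn : I.Nontrivial)
    (h0 : (0 : ℝ) ∈ I) {t : ℝ} (ht : t ∈ I) :
    ∃ a b : ℝ, a < b ∧ Set.Icc a b ⊆ I ∧ (0 : ℝ) ∈ Set.Icc a b ∧ t ∈ Set.Icc a b := by
  obtain ⟨y, hy, hy0, hty⟩ : ∃ y ∈ I, y ≠ 0 ∧ (t = y ∨ t = 0) := by
    by_cases h : t = 0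
    · obtain ⟨y, hy, hy0⟩ := hn.exists_ne 0
      exact ⟨y, hy, hy0, Or.inr h⟩
    · exact ⟨t, ht, h, Or.inl rfl⟩
  refine ⟨min 0 y, max 0 y, ?_, hI.uIcc_subset h0 hy, Set.left_mem_uIcc, ?_⟩
  · rw [min_lt_max]
    exact hy0.symm
  · rcases hty with rfl | rfl
    · exact Set.right_mem_uIcc
    · exact Set.left_mem_uIcc

theorem proposition2p2 (energyBound supBound : ℝ) :
    ∃ C : ℝ, ∀ (I : Set ℝ) (f : ℝ → RVM.R3 → RVM.R3 → ℝ) (E B : ℝ → RVM.R3 → RVM.R3)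
      (f₀ : RVM.R3 → RVM.R3 → ℝ) (E₀ B₀ : RVM.R3 → RVM.R3),
      I.OrdConnected → I.Nontrivial → (0 : ℝ) ∈ I →
      RVM.IsInitialData f₀ E₀ B₀ →
      RVM.IsClassicalSolution I f E B →
      f 0 = f₀ → E 0 = E₀ → B 0 = B₀ →
      RVM.energy f₀ E₀ B₀ ≤ energyBound →
      MeasureTheory.eLpNorm (fun z : RVM.R3 × RVM.R3 => f₀ z.1 z.2) ⊤ MeasureTheory.volume
        ≤ ENNReal.ofReal supBound →
      ∀ t ∈ I,
        (MeasureTheory.MemLp (RVM.rho (f t)) (4 / 3) MeasureTheory.volume ∧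
          MeasureTheory.eLpNorm (RVM.rho (f t)) (4 / 3) MeasureTheory.volume
            ≤ ENNReal.ofReal C) ∧
        (MeasureTheory.MemLp (RVM.cur (f t)) (4 / 3) MeasureTheory.volume ∧
          MeasureTheory.eLpNorm (RVM.cur (f t)) (4 / 3) MeasureTheory.volume
            ≤ ENNReal.ofReal C) := by
  -- `ENNReal.ofReal` sends a negative `supBound` to `0`, so `max supBound 0` is the supremum bound
  -- that the hypothesis really provides.
  refine ⟨((max supBound 0 * MeasureTheory.volume.real (Metric.ball (0 : RVM.R3) 1) + 1) ^
    (4 / 3 : ℝ) * energyBound) ^ (3 / 4 : ℝ), ?_⟩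
  intro I f E B f₀ E₀ B₀ hI hn h0I hdata hsol hf0 hE0 hB0 henergy hsup t htI
  subst hf0 hE0 hB0
  obtain ⟨a, b, hab, hsub, h0, ht⟩ := RVM.exists_Icc_subset hI hn h0I htI
  have h := hsol.mono hsub (uniqueDiffOn_Icc hab)
  have hle := RVM.le_of_eLpNorm_top_le hdata.contDiff_f.continuous (le_max_right supBound 0)
    (hsup.trans (ENNReal.ofReal_le_ofReal (le_max_left _ _)))
  obtain ⟨R, hR⟩ := h.exists_support_bound hab h0 hdata.hasCompactSupport_f
  have hK : IsCompact (Metric.closedBall (0 : RVM.R3 × RVM.R3) R) := isCompact_closedBall _ _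
  have hsupp : ∀ s ∈ Set.Icc a b, ∀ z ∉ Metric.closedBall (0 : RVM.R3 × RVM.R3) R,
      f s z.1 z.2 = 0 := fun s hs z hz => by
    by_contra hne
    obtain ⟨h1, h2⟩ := hR s hs z.1 z.2 hne
    exact hz (by simpa [Prod.norm_def] using ⟨h1, h2⟩)
  have hpos : ∀ s ∈ Set.Icc a b, ∀ x p, 0 ≤ f s x p := fun s hs x p => by
    obtain ⟨x', p', h1, -⟩ := h.exists_eq_initial_position hab h0 hs x p
    exact h1 ▸ hdata.nonneg_f x' p'
  refine RVM.memLp_rho_cur (h.contDiff_density ht).continuous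
    (HasCompactSupport.intro hK (hsupp t ht)) (hpos t ht) (fun x p => ?_)
    ((h.integral_gam_mul_le hK hsupp hpos h0 ht hdata.memLp_E hdata.memLp_B).trans henergy) rfl
  obtain ⟨x', p', h1, -⟩ := h.exists_eq_initial_position hab h0 ht x p
  exact h1 ▸ hle (x', p')
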